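/- Fix $d\ge 0$. A (polyhedral) cone in $\mathbb{R}^d$ is a finite intersection of closed linear halfspaces. A fan in $\mathbb{R}^d$ is a finite (possibly empty) collection $\mathcal N$ of cones such that for all $C,C'\in\mathcal N$ the set $C\cap C'$ is a face of $C$ and $\operatorname{lin}(C)=\operatorname{lin}(C')$; for $\mathcal N\neq\emptyset$ this common linear hull is denoted $\operatorname{lin}(\mathcal N)$. For $S\subseteq\operatorname{lin}(\mathcal N)$ put $\mathcal N\cap S=\{C\cap S: C\in\mathcal N,\ \operatorname{relint}(C)\cap S\ne\emptyset\}$. A fan valuation with values in an abelian group $G$ is a map $\phi$ from fans in $\mathbb{R}^d$ to $G$ with $\phi(\emptyset)=0$ and $\phi(\mathcal N)=\phi(\mathcal N\cap H^{\le})+\phi(\mathcal N\cap H^{\ge})-\phi(\mathcal N\cap H)$ for every nonempty fan $\mathcal N$ and every linear hyperplane $H$ of $\operatorname{lin}(\mathcal N)$ with closed halfspaces $H^{\le},H^{\ge}$; it is rotation-invariant if $\phi(r\mathcal N)=\phi(\mathcal N)$ for all $r\in \mathrm{SO}(d)$ and all fans $\mathcal N$. An arrangement $\mathcal A$ is a finite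 (possibly empty) set of linear hyperplanes of a linear subspace $L\subseteq\mathbb{R}^d$; $\mathcal N(\mathcal A)$ is the fan of closures of the connected components of $L\setminus\bigcup\mathcal A$. Its flats are the intersections of members of $\mathcal A$ (including $L$, the empty intersection), ordered by reverse inclusion, with Möbius function $\mu$ and bottom $\hat 0=L$. The unsigned Whitney numbers of the first kind are $w_i(\mathcal A)=\sum_{F}|\mu(\hat 0,F)|$, the sum over the flats $F$ with $\dim F=i$. For $H\in\mathcal A$ let $\mathcal A\backslash H=\mathcal A\setminus\{H\}$ (in $L$) and $\mathcal A/H=\{H'\cap H: H'\in\mathcal A,\ H'\ne H\}$ (in $H$). Let $\mathcal C$ be either the class of all arrangements in subspaces of $\mathbb{R}^d$ or the class of nonempty ones. A (weak) deletion-restriction invariant on $\mathcal C$ is a map $\psi:\mathcal C\to G$ with $\psi(r\mathcal A)=\psi(\mathcal A)$ for all $r\in\mathrm{SO}(d)$, $\mathcal A\in\mathcal C$, and $\psi(\mathcal A)=\psi(\mathcal A\backslash H)+\psi(\mathcal A/H)$ for all $\mathcal A\in\mathcal C$ and $H\in\mathcal A$ with $\mathcal A\backslash H,\ \mathcal A/H\in\mathcal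 C$. (For nonempty arrangements this excludes exactly the arrangements with a single hyperplane.) For a cone $C$ let $\Pi_k(C)$ be the set of $x\in\mathbb{R}^d$ whose nearest point in $C$ lies in the relative interior of a $k$-dimensional face of $C$; with $B$ the unit ball, the $k$-th spherical intrinsic volume is $v_k(C)=\operatorname{vol}(\Pi_k(C)\cap B)/\operatorname{vol}(B)$, and $v_k(\mathcal N)=\sum_{C\in\mathcal N}v_k(C)$. **Theorem.** Let $G$ be an abelian group. (1) If $\phi$ is a rotation-invariant fan valuation with values in $G$, then there are $g_0,\dots,g_d\in G$ such that for every arrangement $\mathcal A$ $$\phi(\mathcal N(\mathcal A))=g_0w_0(\mathcal A)+\cdots+g_dw_d(\mathcal A).$$ (2) Conversely, let $\mathcal C$ be the class of all arrangements or the class of nonempty arrangements, and let $\psi$ be a $G$-valued (weak) deletion-restriction invariant on $\mathcal C$. Then there is a fan valuation $\phi$ with values in $G$ such that $\psi(\mathcal A)=\phi(\mathcal N(\mathcal A))$ for all $\mathcal A\in\mathcal C$. Moreover $\psi$ is a combination of spherical intrinsic volumes: there are $g_0,\dots,g_d\in G$ such that for all $\mathcal A\in\mathcal C$ the numbers $v_k(\mathcal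 N(\mathcal A))=w_k(\mathcal A)$ are nonnegative integers and $$\psi(\mathcal A)=\sum_{k=0}^d v_k(\mathcal N(\mathcal A))\,g_k;$$ and for every real vector space structure on the group $G$, the map $\mathcal N\mapsto\sum_{k=0}^d v_k(\mathcal N)\,g_k$ is a rotation-invariant fan valuation realizing $\psi$ on $\mathcal C$ in this way. -/

import Mathlib

namespace FanArr

open scoped Classical

/-- The Euclidean space `ℝ^d`. -/
abbrev E (d : ℕ) : Type := EuclideanSpace ℝ (Fin d)

/-! ### Polyhedral cones and fans -/

/-- A polyhedral cone: an intersection of finitely many closed linear halfspaces. -/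
def IsPolyhedralCone {d : ℕ} (C : Set (E d)) : Prop :=
  ∃ s : Finset (E d), C = {x | ∀ a ∈ s, 0 ≤ inner ℝ a x}

/-- A fan in `ℝ^d`: a finite collection of polyhedral cones, with a common linear hull,
such that `C ∩ C'` is a face of `C` for all members `C`, `C'`.
Nonempty faces of a polyhedral cone are its nonempty exposed subsets. -/
structure IsFan {d : ℕ} (N : Set (Set (E d))) : Prop where
  finite : N.Finite
  polyhedral : ∀ C ∈ N, IsPolyhedralCone C
  face : ∀ C ∈ N, ∀ C' ∈ N, IsExposed ℝ C (C ∩ C')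
  lin_eq : ∀ C ∈ N, ∀ C' ∈ N, Submodule.span ℝ C = Submodule.span ℝ C'

/-- The linear hull of a collection of cones; for a nonempty fan this is the
linear hull of each of its members. -/
def lin {d : ℕ} (N : Set (Set (E d))) : Submodule ℝ (E d) := Submodule.span ℝ (⋃₀ N)

/-- `N ∩ S = {C ∩ S : C ∈ N, relint C ∩ S ≠ ∅}`. -/
def cut {d : ℕ} (N : Set (Set (E d))) (S : Set (E d)) : Set (Set (E d)) :=
  (fun C => C ∩ S) '' {C ∈ N | (intrinsicInterior ℝ C ∩ S).Nonempty}

/-- A fan valuation with values in an abelian group `G`. A map on fans is given as a map on all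
collections of sets, on which only the values at fans are constrained. The hyperplanes of
`lin N` are the sets `{x ∈ lin N : ⟪u, x⟫ = 0}` with `0 ≠ u ∈ lin N`. -/
structure IsFanValuation {d : ℕ} {G : Type*} [AddCommGroup G] (φ : Set (Set (E d)) → G) :
    Prop where
  map_empty : φ ∅ = 0
  map_cut : ∀ N, IsFan N → ∀ u ∈ lin N, u ≠ 0 →
    φ N = φ (cut N {x | x ∈ lin N ∧ inner ℝ u x ≤ 0})
      + φ (cut N {x | x ∈ lin N ∧ 0 ≤ inner ℝ u x})
      - φ (cut N {x | x ∈ lin N ∧ inner ℝ u x = 0})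

/-- The rotations of `ℝ^d`: linear isometries of determinant one. -/
def IsRotation {d : ℕ} (r : E d ≃ₗᵢ[ℝ] E d) : Prop :=
  LinearMap.det (r.toLinearEquiv : E d →ₗ[ℝ] E d) = 1

/-- Invariance under rotations of a map on fans. -/
def IsRotationInvariant {d : ℕ} {G : Type*} (φ : Set (Set (E d)) → G) : Prop :=
  ∀ r : E d ≃ₗᵢ[ℝ] E d, IsRotation r → ∀ N, IsFan N → φ ((fun C => r '' C) '' N) = φ N

/-! ### Spherical intrinsic volumes -/

/-- The set `Π_k(C)` of points `x` whose nearest point `y` in `C` lies in the relative interior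
of a `k`-dimensional face of `C`. -/
def projRegion {d : ℕ} (k : ℕ) (C : Set (E d)) : Set (E d) :=
  {x | ∃ y ∈ C, (∀ z ∈ C, ‖x - y‖ ≤ ‖x - z‖) ∧
    ∃ F : Set (E d), IsExposed ℝ C F ∧ y ∈ intrinsicInterior ℝ F ∧
      Module.finrank ℝ (Submodule.span ℝ F) = k}

/-- The `k`-th spherical intrinsic volume of a cone. -/
noncomputable def coneVol {d : ℕ} (k : ℕ) (C : Set (E d)) : ℝ :=
  MeasureTheory.volume.real (projRegion k C ∩ Metric.closedBall (0 : E d) 1) /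
    MeasureTheory.volume.real (Metric.closedBall (0 : E d) 1)

/-- The `k`-th spherical intrinsic volume of a fan, the (finite) sum over its cones. -/
noncomputable def fanVol {d : ℕ} (k : ℕ) (N : Set (Set (E d))) : ℝ :=
  ∑ᶠ C ∈ N, coneVol k C

/-! ### Hyperplane arrangements -/

/-- An arrangement in `ℝ^d`: a finite set of linear hyperplanes of a linear subspace. -/
@[ext]
structure Arrangement (d : ℕ) where
  ambient : Submodule ℝ (E d)
  hyps : Finset (Submodule ℝ (E d))
  le_ambient : ∀ H ∈ hyps, H ≤ ambient
  codim_one : ∀ H ∈ hyps, Module.finrank ℝ H + 1 = Module.finrank ℝ ambient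

/-- Distinct hyperplanes of `L` meet in hyperplanes of each other. -/
theorem finrank_inf_add_one {d : ℕ} {L H K : Submodule ℝ (E d)} (hH : H ≤ L) (hK : K ≤ L)
    (rH : Module.finrank ℝ H + 1 = Module.finrank ℝ L)
    (rK : Module.finrank ℝ K + 1 = Module.finrank ℝ L) (hne : K ≠ H) :
    Module.finrank ℝ (K ⊓ H : Submodule ℝ (E d)) + 1 = Module.finrank ℝ H := by
  have h1 := Submodule.finrank_sup_add_finrank_inf_eq K H
  have h2 : Module.finrank ℝ (K ⊔ H : Submodule ℝ (E d)) ≤ Module.finrank ℝ L :=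
    Submodule.finrank_mono (sup_le hK hH)
  have h3 : Module.finrank ℝ H < Module.finrank ℝ (K ⊔ H : Submodule ℝ (E d)) := by
    apply Submodule.finrank_lt_finrank_of_lt
    refine lt_of_le_of_ne le_sup_right fun h => hne ?_
    have hKH : K ≤ H := h ▸ le_sup_left
    exact Submodule.eq_of_le_of_finrank_eq hKH (by omega)
  omega

namespace Arrangement

variable {d : ℕ}

/-- The deletion of `H`. -/
noncomputable def delete (A : Arrangement d) (H : Submodule ℝ (E d)) : Arrangement d where
  ambient := A.ambient
  hyps := A.hyps.erase H
  le_ambient K hK := A.le_ambient K (Finset.mem_of_mem_erase hK)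
  codim_one K hK := A.codim_one K (Finset.mem_of_mem_erase hK)

/-- The restriction to `H ∈ A`: the arrangement of all `K ∩ H`, `K ∈ A`, `K ≠ H`, in `H`. -/
noncomputable def restrict (A : Arrangement d) (H : Submodule ℝ (E d)) (hH : H ∈ A.hyps) :
    Arrangement d where
  ambient := H
  hyps := (A.hyps.erase H).image (fun K => K ⊓ H)
  le_ambient K hK := by
    obtain ⟨K', _, rfl⟩ := Finset.mem_image.1 hK
    exact inf_le_right
  codim_one K hK := by
    obtain ⟨K', hK', rfl⟩ := Finset.mem_image.1 hK
    obtain ⟨hne, hmem⟩ := Finset.mem_erase.1 hK'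
    exact finrank_inf_add_one (A.le_ambient H hH) (A.le_ambient K' hmem)
      (A.codim_one H hH) (A.codim_one K' hmem) hne

/-- The image of an arrangement under a linear isometry of `ℝ^d`. -/
noncomputable def map (r : E d ≃ₗᵢ[ℝ] E d) (A : Arrangement d) : Arrangement d where
  ambient := A.ambient.map (r.toLinearEquiv : E d →ₗ[ℝ] E d)
  hyps := A.hyps.image (fun H => H.map (r.toLinearEquiv : E d →ₗ[ℝ] E d))
  le_ambient K hK := by
    obtain ⟨H, hH, rfl⟩ := Finset.mem_image.1 hK
    exact Submodule.map_mono (A.le_ambient H hH)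
  codim_one K hK := by
    obtain ⟨H, hH, rfl⟩ := Finset.mem_image.1 hK
    rw [LinearEquiv.finrank_map_eq, LinearEquiv.finrank_map_eq]
    exact A.codim_one H hH

/-- The complement of the hyperplanes in the ambient subspace. -/
def complement (A : Arrangement d) : Set (E d) :=
  {x | x ∈ A.ambient ∧ ∀ H ∈ A.hyps, x ∉ H}

/-- The fan of an arrangement: the closures of the connected components of the complement. -/
def fan (A : Arrangement d) : Set (Set (E d)) :=
  (fun x => closure (connectedComponentIn A.complement x)) '' A.complement

/-- The flats: all intersections of hyperplanes of `A`, the empty intersection being the ambient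
subspace. -/
noncomputable def flats (A : Arrangement d) : Finset (Submodule ℝ (E d)) :=
  A.hyps.powerset.image (fun B => A.ambient ⊓ B.inf id)

theorem ambient_mem_flats (A : Arrangement d) : A.ambient ∈ A.flats :=
  Finset.mem_image.2 ⟨∅, Finset.empty_mem_powerset _, by simp⟩

/-- The lattice of flats, ordered by reverse inclusion. -/
abbrev FlatLattice (A : Arrangement d) : Type := {F : Submodule ℝ (E d) // F ∈ A.flats}ᵒᵈ

noncomputable instance (A : Arrangement d) : LocallyFiniteOrder A.FlatLattice :=
  Fintype.toLocallyFiniteOrder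

/-- The bottom element of the lattice of flats, which is the ambient subspace. -/
def bottomFlat (A : Arrangement d) : A.FlatLattice :=
  OrderDual.toDual ⟨A.ambient, A.ambient_mem_flats⟩

/-- The unsigned Whitney number of the first kind `w_i(A)`, the sum of `|μ(0̂, F)|` over all
flats `F` of dimension `i`. It is the coefficient of `t^i` in `(-1)^(dim A) χ_A(-t)`, where
`χ_A(t) = ∑ F, μ(0̂, F) t^(dim F)` is the characteristic polynomial. -/
noncomputable def whitney (A : Arrangement d) (i : ℕ) : ℕ :=
  ∑ F : A.FlatLattice, if Module.finrank ℝ (OrderDual.ofDual F).1 = i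
    then ((IncidenceAlgebra.mu ℤ : IncidenceAlgebra ℤ A.FlatLattice) A.bottomFlat F).natAbs
    else 0

end Arrangement

/-- `ψ` is a (weak) deletion-restriction invariant on the class `𝒞` of arrangements:
it is invariant under rotations and satisfies `ψ(A) = ψ(A \ H) + ψ(A / H)` whenever the three
arrangements belong to `𝒞`. -/
structure IsDelRestInvariant {d : ℕ} {G : Type*} [AddCommGroup G] (𝒞 : Set (Arrangement d))
    (ψ : Arrangement d → G) : Prop where
  rotation : ∀ r : E d ≃ₗᵢ[ℝ] E d, IsRotation r → ∀ A ∈ 𝒞, ψ (A.map r) = ψ A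
  recurrence : ∀ A ∈ 𝒞, ∀ (H : Submodule ℝ (E d)) (hH : H ∈ A.hyps),
    A.delete H ∈ 𝒞 → A.restrict H hH ∈ 𝒞 → ψ A = ψ (A.delete H) + ψ (A.restrict H hH)

end FanArr

namespace FanArr

open scoped Classical InnerProductSpace Topology
open Submodule Module Filter MeasureTheory

variable {d : ℕ}

/-! ### Relative interiors of polyhedral cones -/

/-! Everything reduces to deletion-restriction. Cutting the fans of `A` and of `A.delete H` along
`H` gives the same two halves. The piece inside `H` is empty for the first fan, since no open
chamber meets `H`, and is the fan of `A.restrict H` for the second. Comparing the two valuation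
identities yields φ(A) = φ(A \ H) + φ(A / H) (`IsFanValuation.map_fan`).

The Whitney numbers obey the same recurrence (`whitney_recurrence`), because the Möbius function is
an alternating sum over sets of hyperplanes whose sign depends only on dimensions. An invariant
obeying the recurrence is thus determined by its values on empty arrangements, where w_i is 1 if i
is the dimension and 0 otherwise. Rotations act transitively on subspaces of a given dimension, so
these values form the coefficients g. With nonempty arrangements only, the base cases are single
hyperplanes H < L. Rotations are transitive on such flags too (`exists_rotation_flag`), and g solves
g_{k+1} + g_k = c_{k+1}, where c_{k+1} is the value on a single hyperplane in dimension k + 1.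

For the realization by valuations, fix a cone, a cutting hyperplane and a generic point x. Among the
cone, its two halves and its slice, the dimensions of the faces receiving the nearest point of x
agree in pairs (`IsGeneric.projRegion`), so the indicators of the regions Π_k satisfy the valuation
identity almost everywhere. Integration makes v_k a valuation, and comparison on subspaces gives v_k
= w_k on arrangements. In a general group G nothing can be integrated. There an ultrafilter finer
than the conull filter replaces the measure by a 0-1 valued choice of generic point (`genericVal`).
-/

theorem mem_intrinsicInterior_iff_of_zero_mem {S : Set (E d)} (h0 : (0 : E d) ∈ S) {y : E d} :
    y ∈ intrinsicInterior ℝ S ↔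
      y ∈ S ∧ ∃ ε > 0, ∀ z ∈ span ℝ S, dist z y < ε → z ∈ S := by
  have haff : ∀ z, z ∈ affineSpan ℝ S ↔ z ∈ span ℝ S := fun z => by
    have := affineSpan_insert_zero (k := ℝ) S
    rw [Set.insert_eq_of_mem h0] at this
    rw [← SetLike.mem_coe, this, SetLike.mem_coe]
  rw [mem_intrinsicInterior]
  constructor
  · rintro ⟨w, hw, rfl⟩
    refine ⟨(interior_subset hw : w ∈ _), ?_⟩
    obtain ⟨ε, hε, h⟩ := Metric.mem_nhds_iff.1 (mem_interior_iff_mem_nhds.1 hw)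
    exact ⟨ε, hε, fun z hz hd => h (a := ⟨z, (haff z).2 hz⟩) hd⟩
  · rintro ⟨hy, ε, hε, h⟩
    refine ⟨⟨y, subset_affineSpan ℝ _ hy⟩, mem_interior_iff_mem_nhds.2 ?_, rfl⟩
    exact Metric.mem_nhds_iff.2 ⟨ε, hε, fun z hz => h z ((haff z).1 z.2) hz⟩

/-- The cone cut out by the halfspaces with the given inner normals. -/
def cone (s : Finset (E d)) : Set (E d) := {x | ∀ a ∈ s, 0 ≤ ⟪a, x⟫_ℝ}

theorem mem_cone {s : Finset (E d)} {x : E d} : x ∈ cone s ↔ ∀ a ∈ s, 0 ≤ ⟪a, x⟫_ℝ := Iff.rfl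

theorem isPolyhedralCone_cone (s : Finset (E d)) : IsPolyhedralCone (cone s) := ⟨s, rfl⟩

theorem zero_mem_cone (s : Finset (E d)) : (0 : E d) ∈ cone s := fun a _ => by simp

theorem convex_cone (s : Finset (E d)) : Convex ℝ (cone s) := by
  intro x hx y hy a b ha hb _ c hc
  rw [inner_add_right, inner_smul_right, inner_smul_right]
  exact add_nonneg (mul_nonneg ha (hx c hc)) (mul_nonneg hb (hy c hc))

theorem isClosed_cone (s : Finset (E d)) : IsClosed (cone s) := by
  simp only [cone, Set.ofPred_forall]
  exact isClosed_biInter fun a _ => isClosed_le continuous_const (by fun_prop)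

/-- The orthogonal complement of a finite set. -/
def ann (t : Finset (E d)) : Submodule ℝ (E d) where
  carrier := {v | ∀ a ∈ t, ⟪a, v⟫_ℝ = 0}
  add_mem' hx hy a ha := by rw [inner_add_right, hx a ha, hy a ha, add_zero]
  zero_mem' a _ := inner_zero_right a
  smul_mem' c x hx a ha := by rw [inner_smul_right, hx a ha, mul_zero]

theorem mem_ann {t : Finset (E d)} {v : E d} : v ∈ ann t ↔ ∀ a ∈ t, ⟪a, v⟫_ℝ = 0 := Iff.rfl

/-- The constraints of a cone which are equalities at a given point. -/
noncomputable def active (s : Finset (E d)) (y : E d) : Finset (E d) :=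
  s.filter fun a => ⟪a, y⟫_ℝ = 0

/-- The linear hull of the minimal face of `cone s` containing `y`. -/
noncomputable def actSpan (s : Finset (E d)) (y : E d) : Submodule ℝ (E d) := ann (active s y)

theorem mem_actSpan {s : Finset (E d)} {y v : E d} :
    v ∈ actSpan s y ↔ ∀ a ∈ s, ⟪a, y⟫_ℝ = 0 → ⟪a, v⟫_ℝ = 0 := by
  simp [actSpan, active, mem_ann]

theorem self_mem_actSpan (s : Finset (E d)) (y : E d) : y ∈ actSpan s y :=
  mem_actSpan.2 fun _ _ h => h

theorem eventually_inner_pos (s : Finset (E d)) (y : E d) :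
    ∀ᶠ z in 𝓝 y, ∀ a ∈ s, 0 < ⟪a, y⟫_ℝ → 0 < ⟪a, z⟫_ℝ := by
  rw [eventually_all_finset]
  intro a _
  by_cases h : 0 < ⟪a, y⟫_ℝ
  · filter_upwards [((continuous_const.inner continuous_id).tendsto y).eventually
      (lt_mem_nhds h)] with z hz _ using hz
  · exact Eventually.of_forall fun z h' => absurd h' h

theorem exists_add_smul_of_eventually {p : E d → Prop} {y : E d} (h : ∀ᶠ z in 𝓝 y, p z)
    (v : E d) : ∃ ε : ℝ, 0 < ε ∧ p (y + ε • v) ∧ p (y - ε • v) := by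
  have h1 : Tendsto (fun t : ℝ => y + t • v) (𝓝[>] 0) (𝓝 y) := by
    have : Continuous fun t : ℝ => y + t • v := by fun_prop
    simpa using (this.tendsto 0).mono_left nhdsWithin_le_nhds
  have h2 : Tendsto (fun t : ℝ => y - t • v) (𝓝[>] 0) (𝓝 y) := by
    have : Continuous fun t : ℝ => y - t • v := by fun_prop
    simpa using (this.tendsto 0).mono_left nhdsWithin_le_nhds
  obtain ⟨ε, h3, h4, h5⟩ :=
    ((h1.eventually h).and ((h2.eventually h).and self_mem_nhdsWithin)).exists
  exact ⟨ε, h5, h3, h4⟩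

/-- Constraints strict at y stay strict nearby, and the active ones hold with equality throughout
`actSpan s y`. -/
theorem eventually_mem_cone {s : Finset (E d)} {y : E d} (hy : y ∈ cone s) :
    ∀ᶠ z in 𝓝 y, z ∈ actSpan s y → z ∈ cone s := by
  filter_upwards [eventually_inner_pos s y] with z hz hT a ha
  rcases (hy a ha).eq_or_lt with h | h
  · exact (mem_actSpan.1 hT a ha h.symm).ge
  · exact (hz a ha h).le

theorem exists_add_mem_cone {s : Finset (E d)} {y v : E d} (hy : y ∈ cone s)
    (hv : v ∈ actSpan s y) : ∃ ε : ℝ, 0 < ε ∧ y + ε • v ∈ cone s ∧ y - ε • v ∈ cone s := by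
  obtain ⟨ε, hε, h1, h2⟩ := exists_add_smul_of_eventually (eventually_mem_cone hy) v
  exact ⟨ε, hε, h1 (add_mem (self_mem_actSpan s y) (smul_mem _ _ hv)),
    h2 (sub_mem (self_mem_actSpan s y) (smul_mem _ _ hv))⟩

theorem exists_extend_of_mem_intrinsicInterior {S : Set (E d)} (h0 : (0 : E d) ∈ S) {y v : E d}
    (hy : y ∈ intrinsicInterior ℝ S) (hv : v ∈ span ℝ S) :
    ∃ ε : ℝ, 0 < ε ∧ y + ε • v ∈ S ∧ y - ε • v ∈ S := by
  obtain ⟨hyS, ε, hε, h⟩ := (mem_intrinsicInterior_iff_of_zero_mem h0).1 hy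
  have : ∀ᶠ z in 𝓝 y, z ∈ span ℝ S → z ∈ S :=
    Metric.eventually_nhds_iff.2 ⟨ε, hε, fun z hd hz => h z hz hd⟩
  obtain ⟨δ, hδ, h1, h2⟩ := exists_add_smul_of_eventually this v
  have hyT := subset_span (R := ℝ) hyS
  exact ⟨δ, hδ, h1 (add_mem hyT (smul_mem _ _ hv)), h2 (sub_mem hyT (smul_mem _ _ hv))⟩

/-- From a relative interior point y one can step a little away from any z of the cone. A constraint
active at y but positive at z would then be violated. The converse is `eventually_mem_cone`. -/
theorem mem_intrinsicInterior_cone {s : Finset (E d)} {y : E d} :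
    y ∈ intrinsicInterior ℝ (cone s) ↔ y ∈ cone s ∧ cone s ⊆ actSpan s y := by
  constructor
  · intro hy
    have hyC := intrinsicInterior_subset hy
    refine ⟨hyC, fun z hz => mem_actSpan.2 fun a ha h => ?_⟩
    obtain ⟨ε, hε, -, h2⟩ :=
      exists_extend_of_mem_intrinsicInterior (zero_mem_cone s) hy (subset_span hz)
    have h2 := h2 a ha
    rw [inner_sub_right, inner_smul_right, h, zero_sub, neg_nonneg] at h2
    exact le_antisymm (nonpos_of_mul_nonpos_right h2 hε) (hz a ha)
  · rintro ⟨hy, h⟩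
    rw [mem_intrinsicInterior_iff_of_zero_mem (zero_mem_cone s)]
    obtain ⟨ε, hε, h'⟩ := Metric.eventually_nhds_iff.1 (eventually_mem_cone hy)
    exact ⟨hy, ε, hε, fun z hz hd => h' hd (span_le.2 h hz)⟩

theorem convex_intrinsicInterior_cone (s : Finset (E d)) :
    Convex ℝ (intrinsicInterior ℝ (cone s)) := by
  intro x hx y hy a b ha hb hab
  rw [mem_intrinsicInterior_cone] at hx hy ⊢
  refine ⟨convex_cone s hx.1 hy.1 ha hb hab, fun z hz => mem_actSpan.2 fun c hc h => ?_⟩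
  rw [inner_add_right, inner_smul_right, inner_smul_right] at h
  have h1 := mul_nonneg ha (hx.1 c hc)
  have h2 := mul_nonneg hb (hy.1 c hc)
  rcases eq_or_ne a 0 with rfl | ha'
  · exact mem_actSpan.1 (hy.2 hz) c hc (by simpa [show b = 1 by linarith] using h)
  · refine mem_actSpan.1 (hx.2 hz) c hc ?_
    have : a * ⟪c, x⟫_ℝ = 0 := by linarith
    simpa [ha'] using this

theorem nonempty_intrinsicInterior_cone (s : Finset (E d)) :
    (intrinsicInterior ℝ (cone s)).Nonempty :=
  Set.Nonempty.intrinsicInterior (convex_cone s) ⟨0, zero_mem_cone s⟩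

theorem add_mem_intrinsicInterior_cone {s : Finset (E d)} {y z : E d}
    (hy : y ∈ intrinsicInterior ℝ (cone s)) (hz : z ∈ cone s) {ε : ℝ} (hε : 0 < ε) :
    z + ε • y ∈ intrinsicInterior ℝ (cone s) := by
  rw [mem_intrinsicInterior_cone] at hy ⊢
  refine ⟨fun a ha => ?_, fun w hw => mem_actSpan.2 fun a ha h => ?_⟩
  · rw [inner_add_right, inner_smul_right]
    exact add_nonneg (hz a ha) (mul_nonneg hε.le (hy.1 a ha))
  · rw [inner_add_right, inner_smul_right] at h
    have h1 := hz a ha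
    have h2 := mul_nonneg hε.le (hy.1 a ha)
    refine mem_actSpan.1 (hy.2 hw) a ha ?_
    have : ε * ⟪a, y⟫_ℝ = 0 := by linarith
    simpa [hε.ne'] using this

/-! ### Nearest points and faces -/

/-- Doubling a maximizer stays in the cone, so the maximum of the exposing functional is at most 0,
its value at the origin. -/
theorem zero_mem_of_isExposed_cone {s : Finset (E d)} {F : Set (E d)}
    (hF : IsExposed ℝ (cone s) F) (hne : F.Nonempty) : (0 : E d) ∈ F := by
  obtain ⟨l, hl⟩ := hF hne
  obtain ⟨y, hy⟩ := hne
  rw [hl] at hy ⊢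
  have h0 : 0 ≤ l y := by simpa using hy.2 0 (zero_mem_cone s)
  have h2 : l y + l y ≤ l y := by
    rw [← map_add]
    refine hy.2 _ fun a ha => ?_
    rw [inner_add_right]
    exact add_nonneg (hy.1 a ha) (hy.1 a ha)
  refine ⟨zero_mem_cone s, fun z hz => ?_⟩
  rw [map_zero]
  exact (hy.2 z hz).trans (by linarith)

/-- A functional maximal at y is constant along directions in which y can move both ways inside the
cone, so those directions stay in the face. Hence the face dimension in `projRegion` can be read off
from the constraints active at y. -/
theorem span_eq_actSpan {s : Finset (E d)} {F : Set (E d)} {y : E d}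
    (hF : IsExposed ℝ (cone s) F) (hy : y ∈ intrinsicInterior ℝ F) :
    span ℝ F = actSpan s y := by
  have hyF := intrinsicInterior_subset hy
  have h0 := zero_mem_of_isExposed_cone hF ⟨y, hyF⟩
  obtain ⟨l, hl⟩ := hF ⟨y, hyF⟩
  apply le_antisymm
  · refine span_le.2 fun z hz => mem_actSpan.2 fun a ha h => ?_
    obtain ⟨ε, hε, -, h2⟩ := exists_extend_of_mem_intrinsicInterior h0 hy (subset_span hz)
    rw [hl] at h2 hz
    have h2 := h2.1 a ha
    rw [inner_sub_right, inner_smul_right, h, zero_sub, neg_nonneg] at h2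
    exact le_antisymm (nonpos_of_mul_nonpos_right h2 hε) (hz.1 a ha)
  · intro v hv
    rw [hl] at hyF
    obtain ⟨ε, hε, h1, h2⟩ := exists_add_mem_cone hyF.1 hv
    have h3 := hyF.2 _ h1
    have h4 := hyF.2 _ h2
    have h5 : l (ε • v) = 0 := by
      rw [map_add] at h3; rw [map_sub] at h4; linarith
    have h6 : y + ε • v ∈ F := by
      rw [hl]; exact ⟨h1, fun z hz => by rw [map_add, h5, add_zero]; exact hyF.2 z hz⟩
    have h7 : y ∈ F := by rw [hl]; exact hyF
    have h8 : ε • v ∈ span ℝ F := by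
      simpa using sub_mem (subset_span (R := ℝ) h6) (subset_span h7)
    exact (smul_mem_iff _ hε.ne').1 h8

theorem isExposed_cone_inter_ann {s t : Finset (E d)} (hts : t ⊆ s) :
    IsExposed ℝ (cone s) (cone s ∩ ann t) := by
  intro _
  -- On the cone the sum over t has nonnegative terms, so it vanishes exactly when every term does.
  refine ⟨-∑ a ∈ t, innerSL ℝ a, ?_⟩
  have key : ∀ x, (-∑ a ∈ t, innerSL ℝ a) x = -∑ a ∈ t, ⟪a, x⟫_ℝ := fun x => by simp
  ext x
  constructor
  · rintro ⟨hx, ht⟩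
    refine ⟨hx, fun z hz => ?_⟩
    rw [key, key, Finset.sum_eq_zero ht]
    simpa using Finset.sum_nonneg fun a ha => hz a (hts ha)
  · rintro ⟨hx, h⟩
    refine ⟨hx, ?_⟩
    have h1 := h 0 (zero_mem_cone s)
    rw [map_zero, key, neg_nonneg] at h1
    exact (Finset.sum_eq_zero_iff_of_nonneg fun a ha => hx a (hts ha)).1
      (h1.antisymm (Finset.sum_nonneg fun a ha => hx a (hts ha)))

theorem exists_face {s : Finset (E d)} {y : E d} (hy : y ∈ cone s) :
    ∃ F, IsExposed ℝ (cone s) F ∧ y ∈ intrinsicInterior ℝ F := by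
  refine ⟨_, isExposed_cone_inter_ann (Finset.filter_subset (fun a => ⟪a, y⟫_ℝ = 0) s), ?_⟩
  change y ∈ intrinsicInterior ℝ (cone s ∩ actSpan s y)
  rw [mem_intrinsicInterior_iff_of_zero_mem (Set.mem_inter (zero_mem_cone s) (zero_mem _))]
  obtain ⟨ε, hε, h⟩ := Metric.eventually_nhds_iff.1 (eventually_mem_cone hy)
  refine ⟨⟨hy, self_mem_actSpan s y⟩, ε, hε, fun z hz hd => ?_⟩
  have hz' : z ∈ actSpan s y := span_le.2 Set.inter_subset_right hz
  exact ⟨h hd hz', hz'⟩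

/-- `y` is the nearest point to `x` in `C`. -/
def IsNearest (C : Set (E d)) (x y : E d) : Prop := y ∈ C ∧ ∀ z ∈ C, ‖x - y‖ ≤ ‖x - z‖

theorem mem_projRegion_cone {k : ℕ} {s : Finset (E d)} {x : E d} :
    x ∈ projRegion k (cone s) ↔ ∃ y, IsNearest (cone s) x y ∧ finrank ℝ (actSpan s y) = k := by
  constructor
  · rintro ⟨y, hy, hn, F, hF, hyF, hk⟩
    exact ⟨y, ⟨hy, hn⟩, by rw [← span_eq_actSpan hF hyF, hk]⟩
  · rintro ⟨y, hy, hk⟩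
    obtain ⟨F, hF, hyF⟩ := exists_face hy.1
    exact ⟨y, hy.1, hy.2, F, hF, hyF, by rw [span_eq_actSpan hF hyF, hk]⟩

theorem isNearest_iff {C : Set (E d)} (hC : Convex ℝ C) {x y : E d} :
    IsNearest C x y ↔ y ∈ C ∧ ∀ z ∈ C, ⟪x - y, z - y⟫_ℝ ≤ 0 := by
  refine and_congr_right fun hy => ?_
  rw [← norm_eq_iInf_iff_real_inner_le_zero hC hy]
  have : Nonempty C := ⟨⟨y, hy⟩⟩
  have hb : BddBelow (Set.range fun w : C => ‖x - w‖) :=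
    ⟨0, by rintro _ ⟨w, rfl⟩; exact norm_nonneg _⟩
  constructor
  · intro h
    exact le_antisymm (le_ciInf fun w => h w w.2) (ciInf_le hb ⟨y, hy⟩)
  · intro h z hz
    rw [h]
    exact ciInf_le hb ⟨z, hz⟩

theorem exists_isNearest (s : Finset (E d)) (x : E d) : ∃ y, IsNearest (cone s) x y := by
  obtain ⟨y, hy, h⟩ := (isClosed_cone s).exists_infDist_eq_dist ⟨0, zero_mem_cone s⟩ x
  refine ⟨y, hy, fun z hz => ?_⟩
  rw [← dist_eq_norm, ← dist_eq_norm, ← h]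
  exact Metric.infDist_le_dist_of_mem hz

/-- Adding the two variational inequalities gives ‖y' - y‖² ≤ 0. -/
theorem IsNearest.unique {C : Set (E d)} (hC : Convex ℝ C) {x y y' : E d}
    (h : IsNearest C x y) (h' : IsNearest C x y') : y = y' := by
  rw [isNearest_iff hC] at h h'
  have h1 := h.2 y' h'.1
  have h2 := h'.2 y h.1
  have h3 : ⟪y' - y, y' - y⟫_ℝ = ⟪x - y, y' - y⟫_ℝ + ⟪x - y', y - y'⟫_ℝ := by
    rw [← neg_sub y' y, inner_neg_right, ← sub_eq_add_neg, ← inner_sub_left]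
    congr 1; abel
  have h4 : ⟪y' - y, y' - y⟫_ℝ = 0 := le_antisymm (by linarith) real_inner_self_nonneg
  exact (sub_eq_zero.1 (inner_self_eq_zero.1 h4)).symm

theorem IsNearest.mono {C C' : Set (E d)} (hCC : C' ⊆ C) {x y : E d} (h : IsNearest C x y)
    (hy : y ∈ C') : IsNearest C' x y :=
  ⟨hy, fun z hz => h.2 z (hCC hz)⟩

/-- Since y can move both ways along `actSpan s y`, the variational inequality becomes an equality
there. -/
theorem IsNearest.sub_mem_orthogonal {s : Finset (E d)} {x y : E d}
    (h : IsNearest (cone s) x y) : x - y ∈ (actSpan s y)ᗮ := by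
  rw [isNearest_iff (convex_cone s)] at h
  rw [mem_orthogonal']
  intro v hv
  obtain ⟨ε, hε, h1, h2⟩ := exists_add_mem_cone h.1 hv
  have h1 := h.2 _ h1
  have h2 := h.2 _ h2
  simp only [add_sub_cancel_left, sub_sub_cancel_left, inner_neg_right, inner_smul_right,
    neg_nonpos] at h1 h2
  have : ε * ⟪x - y, v⟫_ℝ = 0 := le_antisymm h1 h2
  simpa [hε.ne'] using this

/-! ### Cutting a cone by a hyperplane -/

theorem cone_insert (u : E d) (s : Finset (E d)) :
    cone (insert u s) = cone s ∩ {x | 0 ≤ ⟪u, x⟫_ℝ} := by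
  ext x
  simp [mem_cone, and_comm]

theorem cone_insert_neg (u : E d) (s : Finset (E d)) :
    cone (insert (-u) s) = cone s ∩ {x | ⟪u, x⟫_ℝ ≤ 0} := by
  ext x
  simp [mem_cone, and_comm]

theorem cone_insert_insert_neg (u : E d) (s : Finset (E d)) :
    cone (insert u (insert (-u) s)) = cone s ∩ {x | ⟪u, x⟫_ℝ = 0} := by
  ext x
  simp only [cone_insert, Set.mem_inter_iff, Set.mem_ofPred_eq, and_assoc,
    le_antisymm_iff, inner_neg_left, neg_nonneg]

theorem mem_ann_singleton {u v : E d} : v ∈ ann {u} ↔ ⟪u, v⟫_ℝ = 0 := by simp [mem_ann]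

theorem ann_singleton_neg (u : E d) : ann {-u} = ann {u} := by
  ext v; simp [mem_ann_singleton]

theorem actSpan_insert_of_ne {u y : E d} (s : Finset (E d)) (h : ⟪u, y⟫_ℝ ≠ 0) :
    actSpan (insert u s) y = actSpan s y := by
  ext v; simp [mem_actSpan, h]

theorem actSpan_insert_of_eq {u y : E d} (s : Finset (E d)) (h : ⟪u, y⟫_ℝ = 0) :
    actSpan (insert u s) y = actSpan s y ⊓ ann {u} := by
  ext v; simp [mem_actSpan, h, mem_ann_singleton, and_comm]

theorem mem_projRegion_iff_of_actSpan_eq {s s' : Finset (E d)} {x y y' : E d}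
    (h : IsNearest (cone s) x y) (h' : IsNearest (cone s') x y')
    (heq : actSpan s y = actSpan s' y') (k : ℕ) :
    x ∈ projRegion k (cone s) ↔ x ∈ projRegion k (cone s') := by
  rw [mem_projRegion_cone, mem_projRegion_cone]
  constructor
  · rintro ⟨z, hz, hk⟩
    rw [hz.unique (convex_cone s) h, heq] at hk
    exact ⟨y', h', hk⟩
  · rintro ⟨z, hz, hk⟩
    rw [hz.unique (convex_cone s') h', ← heq] at hk
    exact ⟨y, h, hk⟩

/-- `x` avoids the points projecting into a face of `cone s` at which the hyperplane with
normal `u` properly cuts that face. -/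
def IsGeneric (s : Finset (E d)) (u x : E d) : Prop :=
  ∀ t ⊆ s, ¬ ann t ≤ ann {u} → x ∉ (ann t ⊓ ann {u}) ⊔ (ann t)ᗮ

/-- Each excluded set is a proper subspace, hence null, and only finitely many sets t of constraints
occur. -/
theorem ae_isGeneric (s : Finset (E d)) (u : E d) :
    ∀ᵐ x ∂(MeasureTheory.volume : MeasureTheory.Measure (E d)), IsGeneric s u x := by
  have key : ∀ t : Finset (E d), ∀ᵐ x ∂(MeasureTheory.volume : MeasureTheory.Measure (E d)),
      ¬ ann t ≤ ann {u} → x ∉ (ann t ⊓ ann {u}) ⊔ (ann t)ᗮ := by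
    intro t
    by_cases h : ann t ≤ ann {u}
    · exact Eventually.of_forall fun x h' => absurd h h'
    have hne : (ann t ⊓ ann {u}) ⊔ (ann t)ᗮ ≠ ⊤ := by
      intro htop
      refine h fun v hv => ?_
      obtain ⟨a, ha, b, hb, rfl⟩ := Submodule.mem_sup.1 (htop.symm ▸ mem_top :
        v ∈ (ann t ⊓ ann {u}) ⊔ (ann t)ᗮ)
      have hb' : b ∈ ann t := by simpa using sub_mem hv ha.1
      have : b = 0 := by
        have := (mem_orthogonal _ _).1 hb b hb'
        exact inner_self_eq_zero.1 this
      rw [this, add_zero]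
      exact ha.2
    have h0 := MeasureTheory.Measure.addHaar_submodule MeasureTheory.volume _ hne
    filter_upwards [MeasureTheory.measure_eq_zero_iff_ae_notMem.1 h0] with x hx _ using hx
  have := (eventually_all_finset s.powerset).2 fun t _ => key t
  filter_upwards [this] with x hx t ht using hx t (Finset.mem_powerset.2 ht)

theorem IsGeneric.neg {s : Finset (E d)} {u x : E d} (h : IsGeneric s u x) :
    IsGeneric s (-u) x := by
  intro t ht
  rw [ann_singleton_neg]
  exact h t ht

theorem IsGeneric.actSpan_le {s : Finset (E d)} {u x y : E d} (h : IsGeneric s u x)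
    (hy : IsNearest (cone s) x y) (hu : ⟪u, y⟫_ℝ = 0) : actSpan s y ≤ ann {u} := by
  by_contra hle
  refine h _ (Finset.filter_subset _ _) hle ?_
  have : x = y + (x - y) := by abel
  rw [this]
  exact add_mem (mem_sup_left ⟨self_mem_actSpan s y, mem_ann_singleton.2 hu⟩)
    (mem_sup_right hy.sub_mem_orthogonal)

/-- If y' lay strictly inside the half where u is nonnegative, moving from y' towards y would stay
in that half for a while. The variational inequalities at y and y' then force y = y', although u is
nonpositive at y. -/
theorem IsNearest.inner_eq_zero {s : Finset (E d)} {u x y y' : E d}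
    (hy : IsNearest (cone s) x y) (hu : ⟪u, y⟫_ℝ ≤ 0)
    (hy' : IsNearest (cone (insert u s)) x y') : ⟪u, y'⟫_ℝ = 0 := by
  have hy'C : y' ∈ cone s ∩ {x | 0 ≤ ⟪u, x⟫_ℝ} := cone_insert u s ▸ hy'.1
  by_contra hne
  have hpos : 0 < ⟪u, y'⟫_ℝ := lt_of_le_of_ne hy'C.2 (Ne.symm hne)
  -- The parameter at which the segment from y' to y meets the hyperplane.
  set t : ℝ := ⟪u, y'⟫_ℝ / (⟪u, y'⟫_ℝ - ⟪u, y⟫_ℝ) with ht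
  have hden : 0 < ⟪u, y'⟫_ℝ - ⟪u, y⟫_ℝ := by linarith
  have ht0 : 0 < t := div_pos hpos hden
  have ht1 : t ≤ 1 := (div_le_one hden).2 (by linarith)
  have hp : (1 - t) • y' + t • y ∈ cone (insert u s) := by
    rw [cone_insert]
    refine ⟨convex_cone s hy'C.1 hy.1 (by linarith) ht0.le (by ring), ?_⟩
    have : t * (⟪u, y'⟫_ℝ - ⟪u, y⟫_ℝ) = ⟪u, y'⟫_ℝ := div_mul_cancel₀ _ hden.ne'
    change 0 ≤ ⟪u, _⟫_ℝ
    rw [inner_add_right, inner_smul_right, inner_smul_right]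
    linarith
  have h1 := ((isNearest_iff (convex_cone _)).1 hy').2 _ hp
  rw [show (1 - t) • y' + t • y - y' = t • (y - y') by module, inner_smul_right] at h1
  have h2 := nonpos_of_mul_nonpos_right h1 ht0
  have h3 := ((isNearest_iff (convex_cone _)).1 hy).2 _ hy'C.1
  have h4 : ⟪y' - y, y' - y⟫_ℝ = ⟪x - y, y' - y⟫_ℝ + ⟪x - y', y - y'⟫_ℝ := by
    rw [← neg_sub y' y, inner_neg_right, ← sub_eq_add_neg, ← inner_sub_left]
    congr 1; abel
  have h5 : ⟪y' - y, y' - y⟫_ℝ = 0 := le_antisymm (by linarith) real_inner_self_nonneg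
  rw [sub_eq_zero.1 (inner_self_eq_zero.1 h5)] at hpos
  linarith

/-- The cone and its nonpositive half share the nearest point y. If y lies on the hyperplane,
genericity makes the extra active constraint redundant. The nonnegative half and the slice share
their nearest point by `IsNearest.inner_eq_zero`, and u is active there for both. -/
theorem IsGeneric.projRegion_of_nonpos {s : Finset (E d)} {u x y : E d} (h : IsGeneric s u x)
    (hy : IsNearest (cone s) x y) (hu : ⟪u, y⟫_ℝ ≤ 0) (k : ℕ) :
    (x ∈ projRegion k (cone s) ↔ x ∈ projRegion k (cone (insert (-u) s))) ∧
    (x ∈ projRegion k (cone (insert u s)) ↔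
      x ∈ projRegion k (cone (insert u (insert (-u) s)))) := by
  constructor
  · refine mem_projRegion_iff_of_actSpan_eq hy (hy.mono ?_ ?_) ?_ k
    · rw [cone_insert_neg]; exact Set.inter_subset_left
    · rw [cone_insert_neg]; exact ⟨hy.1, hu⟩
    · by_cases h0 : ⟪u, y⟫_ℝ = 0
      · rw [actSpan_insert_of_eq _ (by simpa using h0), ann_singleton_neg,
          inf_eq_left.2 (h.actSpan_le hy h0)]
      · rw [actSpan_insert_of_ne _ (by simpa using h0)]
  · obtain ⟨y', hy'⟩ := exists_isNearest (insert u s) x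
    have h0 := hy.inner_eq_zero hu hy'
    have hC : y' ∈ cone s ∩ {x | 0 ≤ ⟪u, x⟫_ℝ} := cone_insert u s ▸ hy'.1
    refine mem_projRegion_iff_of_actSpan_eq hy' (hy'.mono ?_ ?_) ?_ k
    · rw [cone_insert_insert_neg, cone_insert]
      exact Set.inter_subset_inter_right _ fun x (hx : _ = _) => hx.ge
    · rw [cone_insert_insert_neg]; exact ⟨hC.1, h0⟩
    · rw [actSpan_insert_of_eq _ h0, actSpan_insert_of_eq _ h0,
        actSpan_insert_of_eq _ (by simpa using h0), ann_singleton_neg, inf_assoc, inf_idem]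

/-- In either case the four indicators cancel in pairs, which is the valuation identity at the point
x. The case depends on the side of the nearest point and not on k. -/
theorem IsGeneric.projRegion {s : Finset (E d)} {u x : E d} (h : IsGeneric s u x) :
    (∀ k, (x ∈ projRegion k (cone s) ↔ x ∈ projRegion k (cone (insert (-u) s))) ∧
      (x ∈ projRegion k (cone (insert u s)) ↔
        x ∈ projRegion k (cone (insert u (insert (-u) s))))) ∨
    (∀ k, (x ∈ projRegion k (cone s) ↔ x ∈ projRegion k (cone (insert u s))) ∧
      (x ∈ projRegion k (cone (insert (-u) s)) ↔
        x ∈ projRegion k (cone (insert u (insert (-u) s))))) := by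
  obtain ⟨y, hy⟩ := exists_isNearest s x
  rcases le_total ⟪u, y⟫_ℝ 0 with hu | hu
  · exact Or.inl fun k => h.projRegion_of_nonpos hy hu k
  · have := h.neg.projRegion_of_nonpos hy (by simpa using hu)
    rw [neg_neg, Finset.insert_comm] at this
    exact Or.inr this

/-! ### Fan valuations from valuations of cones -/

/-- A valuation on polyhedral cones, with respect to cuts by linear hyperplanes. -/
def IsConeValuation {M : Type*} [AddCommGroup M] (f : Set (E d) → M) : Prop :=
  ∀ (s : Finset (E d)) (u : E d), f (cone s) =
    f (cone (insert (-u) s)) + f (cone (insert u s)) - f (cone (insert u (insert (-u) s)))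

/-- If C ∩ S = C' ∩ S, a relative interior point of C in S lies in the face C ∩ C' of C, and a face
containing such a point is all of C. So no terms merge when a sum over N is transferred to its cut.
-/
theorem cut_injOn {N : Set (Set (E d))} (hN : IsFan N) (S : Set (E d)) :
    Set.InjOn (fun C => C ∩ S) {C ∈ N | (intrinsicInterior ℝ C ∩ S).Nonempty} := by
  have key : ∀ C ∈ N, (intrinsicInterior ℝ C ∩ S).Nonempty → ∀ C' ∈ N, C ∩ S = C' ∩ S →
      C ⊆ C' := by
    rintro C hC ⟨x, hx, hxS⟩ C' hC' h z hz
    obtain ⟨s, rfl⟩ := hN.polyhedral C hC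
    have hxC := intrinsicInterior_subset hx
    have hx' : x ∈ C' := (h ▸ ⟨hxC, hxS⟩ : x ∈ C' ∩ S).1
    obtain ⟨l, hl⟩ := hN.face _ hC C' hC' ⟨x, hxC, hx'⟩
    have hxl := ((Set.ext_iff.1 hl x).1 ⟨hxC, hx'⟩).2
    obtain ⟨ε, hε, -, h2⟩ := exists_extend_of_mem_intrinsicInterior (zero_mem_cone s) hx
      (sub_mem (subset_span (R := ℝ) hz) (subset_span hxC))
    have h3 := hxl _ h2
    rw [map_sub, map_smul, map_sub, smul_eq_mul] at h3
    have h4 : l x ≤ l z := by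
      by_contra hlt
      have := mul_neg_of_pos_of_neg hε (sub_neg.2 (not_le.1 hlt))
      linarith
    exact ((Set.ext_iff.1 hl z).2 ⟨hz, fun w hw => (hxl w hw).trans h4⟩).2
  rintro C ⟨hC, h1⟩ C' ⟨hC', h2⟩ h
  exact (key C hC h1 C' hC' h).antisymm (key C' hC' h2 C hC h.symm)

theorem finsum_cut {M : Type*} [AddCommGroup M] (f : Set (E d) → M) {N : Set (Set (E d))}
    (hN : IsFan N) (S : Set (E d)) :
    ∑ᶠ C ∈ cut N S, f C = ∑ C ∈ hN.finite.toFinset,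
      if (intrinsicInterior ℝ C ∩ S).Nonempty then f (C ∩ S) else 0 := by
  rw [cut, finsum_mem_image (cut_injOn hN S), ← Finset.sum_filter,
    ← finsum_mem_coe_finset]
  congr 1
  ext C
  simp

theorem span_eq_lin {N : Set (Set (E d))} (hN : IsFan N) {C : Set (E d)} (hC : C ∈ N) :
    span ℝ C = lin N := by
  apply le_antisymm
  · exact span_mono (Set.subset_sUnion_of_mem hC)
  · refine span_le.2 ?_
    rintro x ⟨C', hC', hx⟩
    rw [hN.lin_eq C hC C' hC']
    exact subset_span hx

/-- If the relative interior meets the hyperplane, all three pieces survive and the cone identity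
applies. Otherwise the relative interior, being convex, lies strictly on one side, and the only
surviving piece is the whole cone. -/
theorem IsConeValuation.eq_cut {M : Type*} [AddCommGroup M] {f : Set (E d) → M}
    (hf : IsConeValuation f) (s : Finset (E d)) (u : E d) :
    f (cone s) =
      (if (intrinsicInterior ℝ (cone s) ∩ {x | ⟪u, x⟫_ℝ ≤ 0}).Nonempty
        then f (cone s ∩ {x | ⟪u, x⟫_ℝ ≤ 0}) else 0)
      + (if (intrinsicInterior ℝ (cone s) ∩ {x | 0 ≤ ⟪u, x⟫_ℝ}).Nonempty
        then f (cone s ∩ {x | 0 ≤ ⟪u, x⟫_ℝ}) else 0)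
      - (if (intrinsicInterior ℝ (cone s) ∩ {x | ⟪u, x⟫_ℝ = 0}).Nonempty
        then f (cone s ∩ {x | ⟪u, x⟫_ℝ = 0}) else 0) := by
  by_cases h0 : (intrinsicInterior ℝ (cone s) ∩ {x | ⟪u, x⟫_ℝ = 0}).Nonempty
  · obtain ⟨x, hx, hx0⟩ := h0
    rw [if_pos ⟨x, hx, le_of_eq hx0⟩, if_pos ⟨x, hx, ge_of_eq hx0⟩, if_pos ⟨x, hx, hx0⟩,
      hf s u, cone_insert_neg, cone_insert_insert_neg, cone_insert]
  · obtain ⟨y, hy⟩ := nonempty_intrinsicInterior_cone s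
    have hone : ∀ w : E d, (∀ x ∈ intrinsicInterior ℝ (cone s), ⟪w, x⟫_ℝ ≠ 0) → 0 < ⟪w, y⟫_ℝ →
        (∀ x ∈ intrinsicInterior ℝ (cone s), 0 < ⟪w, x⟫_ℝ) ∧ ∀ x ∈ cone s, 0 ≤ ⟪w, x⟫_ℝ := by
      intro w hw hwy
      have h1 : ∀ x ∈ intrinsicInterior ℝ (cone s), 0 < ⟪w, x⟫_ℝ := by
        intro x hx
        by_contra hneg
        have hlt : ⟪w, x⟫_ℝ < 0 := lt_of_le_of_ne (not_lt.1 hneg) (hw x hx)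
        have hden : 0 < ⟪w, y⟫_ℝ - ⟪w, x⟫_ℝ := by linarith
        -- The weights are those of the zero of w on the segment from x to y.
        refine hw _ (convex_intrinsicInterior_cone s hx hy
          (div_nonneg hwy.le hden.le) (div_nonneg (neg_nonneg.2 hlt.le) hden.le) ?_) ?_
        · rw [← add_div, ← sub_eq_add_neg, div_self hden.ne']
        · rw [inner_add_right, inner_smul_right, inner_smul_right]; ring
      refine ⟨h1, fun x hx => ?_⟩
      by_contra hneg
      have hlt := not_le.1 hneg
      -- Adding this multiple of y only halves the negative value of w at x, yet moves the point
      -- into the relative interior.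
      have hε : 0 < -⟪w, x⟫_ℝ / (2 * ⟪w, y⟫_ℝ) := div_pos (by linarith) (by linarith)
      have h2 := h1 _ (add_mem_intrinsicInterior_cone hy hx hε)
      rw [inner_add_right, inner_smul_right] at h2
      have : -⟪w, x⟫_ℝ / (2 * ⟪w, y⟫_ℝ) * ⟪w, y⟫_ℝ = -⟪w, x⟫_ℝ / 2 := by
        field_simp
      linarith
    have h0' : ∀ x ∈ intrinsicInterior ℝ (cone s), ⟪u, x⟫_ℝ ≠ 0 := fun x hx h =>
      h0 ⟨x, hx, h⟩
    rw [if_neg h0, sub_zero]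
    rcases lt_or_gt_of_ne (h0' y hy) with hlt | hlt
    · obtain ⟨h1, h2⟩ := hone (-u) (fun x hx => by simpa using h0' x hx) (by simpa using hlt)
      simp only [inner_neg_left, neg_pos, neg_nonneg] at h1 h2
      rw [if_pos ⟨y, hy, hlt.le⟩, if_neg, add_zero,
        Set.inter_eq_left (t := {x | ⟪u, x⟫_ℝ ≤ 0}).2 h2]
      rintro ⟨x, hx, hx'⟩
      exact (h1 x hx).not_ge hx'
    · obtain ⟨h1, h2⟩ := hone u h0' hlt
      rw [if_neg, zero_add, if_pos ⟨y, hy, hlt.le⟩,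
        Set.inter_eq_left (t := {x | 0 ≤ ⟪u, x⟫_ℝ}).2 h2]
      rintro ⟨x, hx, hx'⟩
      exact (h1 x hx).not_ge hx'

theorem IsConeValuation.isFanValuation {M : Type*} [AddCommGroup M] {f : Set (E d) → M}
    (hf : IsConeValuation f) :
    IsFanValuation (fun N : Set (Set (E d)) => ∑ᶠ C ∈ N, f C) where
  map_empty := by simp
  map_cut N hN u _ _ := by
    simp only [finsum_cut f hN]
    rw [← Finset.sum_add_distrib, ← Finset.sum_sub_distrib,
      ← finsum_mem_coe_finset]
    rw [hN.finite.coe_toFinset]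
    refine finsum_mem_congr rfl fun C hC => ?_
    obtain ⟨s, hs⟩ := hN.polyhedral C hC
    change C = cone s at hs
    subst hs
    have hsub : cone s ⊆ lin N := span_eq_lin hN hC ▸ subset_span
    have hsub' := intrinsicInterior_subset (𝕜 := ℝ) (s := cone s)
    have e : ∀ p : E d → Prop, cone s ∩ {x | x ∈ lin N ∧ p x} = cone s ∩ {x | p x} :=
      fun p => by
        ext x
        exact ⟨fun h => ⟨h.1, h.2.2⟩, fun h => ⟨h.1, hsub h.1, h.2⟩⟩
    have e' : ∀ p : E d → Prop, intrinsicInterior ℝ (cone s) ∩ {x | x ∈ lin N ∧ p x} =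
        intrinsicInterior ℝ (cone s) ∩ {x | p x} :=
      fun p => by
        ext x
        exact ⟨fun h => ⟨h.1, h.2.2⟩, fun h => ⟨h.1, hsub (hsub' h.1), h.2⟩⟩
    rw [e, e, e, e', e', e']
    exact hf.eq_cut s u

/-! ### Spherical intrinsic volumes as valuations -/

/-- Split by the set t of constraints active at the nearest point, which is then the orthogonal
projection to `ann t`. Each of the finitely many parts is cut out by closed conditions and
complements of closed ones. -/
theorem measurableSet_projRegion (k : ℕ) (s : Finset (E d)) :
    MeasurableSet (projRegion k (cone s)) := by
  have : projRegion k (cone s) = ⋃ t ∈ s.powerset.filter fun t => finrank ℝ (ann t) = k,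
      ((ann t).starProjection ⁻¹' cone s ∩
        ⋂ a ∈ s, {x | ⟪a, (ann t).starProjection x⟫_ℝ = 0 ↔ a ∈ t}) ∩
        ⋂ z ∈ cone s,
          {x | ⟪x - (ann t).starProjection x, z - (ann t).starProjection x⟫_ℝ ≤ 0} := by
    ext x
    simp only [mem_projRegion_cone, Set.mem_iUnion, Finset.mem_filter, Finset.mem_powerset,
      exists_prop, Set.mem_inter_iff, Set.mem_iInter, Set.mem_preimage, Set.mem_ofPred_eq,
      isNearest_iff (convex_cone s)]
    constructor
    · rintro ⟨y, hy, hk⟩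
      have hp : (ann (active s y)).starProjection x = y :=
        eq_starProjection_of_mem_orthogonal (self_mem_actSpan s y)
          (((isNearest_iff (convex_cone s)).2 hy).sub_mem_orthogonal)
      refine ⟨active s y, ⟨Finset.filter_subset _ _, hk⟩, ?_⟩
      rw [hp]
      exact ⟨⟨hy.1, fun a ha => by simp [active, ha]⟩, hy.2⟩
    · rintro ⟨t, ⟨hts, hk⟩, ⟨h1, h2⟩, h3⟩
      refine ⟨_, ⟨h1, h3⟩, ?_⟩
      have : active s ((ann t).starProjection x) = t := by
        ext a
        simp only [active, Finset.mem_filter]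
        exact ⟨fun h => (h2 a h.1).1 h.2, fun h => ⟨hts h, (h2 a (hts h)).2 h⟩⟩
      rw [actSpan, this, hk]
  rw [this]
  refine Finset.measurableSet_biUnion _ fun t _ => ((?_ : MeasurableSet _).inter ?_).inter ?_
  · exact ((isClosed_cone s).preimage (by fun_prop)).measurableSet
  · refine Finset.measurableSet_biInter _ fun a _ => ?_
    have h0 : MeasurableSet {x : E d | ⟪a, (ann t).starProjection x⟫_ℝ = 0} :=
      (isClosed_eq (by fun_prop) continuous_const).measurableSet
    by_cases h : a ∈ t
    · simpa [h] using h0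
    · simp only [h, iff_false]
      exact h0.compl
  · exact (isClosed_biInter fun z _ =>
      isClosed_le (by fun_prop) continuous_const).measurableSet

theorem coneVol_cone (k : ℕ) (s : Finset (E d)) :
    coneVol k (cone s) = (∫ x in Metric.closedBall (0 : E d) 1,
      (projRegion k (cone s)).indicator (1 : E d → ℝ) x) /
        volume.real (Metric.closedBall (0 : E d) 1) := by
  rw [coneVol, integral_indicator_one (measurableSet_projRegion k s),
    measureReal_restrict_apply (measurableSet_projRegion k s)]

theorem isConeValuation_coneVol (k : ℕ) : IsConeValuation (d := d) (coneVol k) := by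
  intro s u
  have hint : ∀ t : Finset (E d), Integrable ((projRegion k (cone t)).indicator (1 : E d → ℝ))
      (volume.restrict (Metric.closedBall (0 : E d) 1)) := fun t => by
    have : IsFiniteMeasure ((volume : Measure (E d)).restrict (Metric.closedBall (0 : E d) 1)) :=
      ⟨by simpa using measure_closedBall_lt_top⟩
    exact (integrable_const (1 : ℝ)).indicator (measurableSet_projRegion k t)
  simp only [coneVol_cone]
  rw [← add_div, ← sub_div, ← integral_add' (hint _) (hint _), ← integral_sub'
    ((hint _).add (hint _)) (hint _)]
  congr 1
  refine integral_congr_ae (ae_restrict_of_ae ?_)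
  filter_upwards [ae_isGeneric s u] with x hx
  simp only [Pi.sub_apply, Pi.add_apply, Set.indicator_apply]
  rcases hx.projRegion with h | h
  · rw [if_congr (h k).1 rfl rfl, if_congr (h k).2 rfl rfl, add_sub_cancel_right]
  · rw [if_congr (h k).1 rfl rfl, if_congr (h k).2 rfl rfl, add_sub_cancel_left]

theorem isFanValuation_fanVol (k : ℕ) : IsFanValuation (d := d) (fanVol k) :=
  (isConeValuation_coneVol k).isFanValuation

/-- The combination with coefficients `g k` of the indicators of the sets `projRegion k C`,
evaluated at a point which is generic in the sense of an ultrafilter on the conull sets. -/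
noncomputable def genericVal {M : Type*} [AddCommGroup M] {n : ℕ} (g : Fin n → M)
    (C : Set (E d)) : M :=
  ∑ k : Fin n, if ∀ᶠ x in (Ultrafilter.of (ae (volume : Measure (E d))) : Filter (E d)),
    x ∈ projRegion k C then g k else 0

/-- The ultrafilter contains the conull set of generic points and decides which alternative of
`IsGeneric.projRegion` holds. The terms then cancel in pairs for every k. -/
theorem isConeValuation_genericVal {M : Type*} [AddCommGroup M] {n : ℕ} (g : Fin n → M) :
    IsConeValuation (d := d) (genericVal g) := by
  intro s u
  have hgen : ∀ᶠ x in (Ultrafilter.of (ae (volume : Measure (E d))) : Filter (E d)),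
      IsGeneric s u x := (Ultrafilter.of_le _) (ae_isGeneric s u)
  have := Ultrafilter.eventually_or.1 (hgen.mono fun x hx => hx.projRegion)
  simp only [genericVal]
  rw [← Finset.sum_add_distrib, ← Finset.sum_sub_distrib]
  refine Finset.sum_congr rfl fun k _ => ?_
  rcases this with h | h
  · rw [if_congr (eventually_congr (h.mono fun x hx => (hx k).1)) rfl rfl,
      if_congr (eventually_congr (h.mono fun x hx => (hx k).2)) rfl rfl, add_sub_cancel_right]
  · rw [if_congr (eventually_congr (h.mono fun x hx => (hx k).1)) rfl rfl,
      if_congr (eventually_congr (h.mono fun x hx => (hx k).2)) rfl rfl, add_sub_cancel_left]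

/-! ### Linear subspaces as cones -/

theorem exists_cone_eq (L : Submodule ℝ (E d)) : ∃ s : Finset (E d), cone s = L := by
  obtain ⟨t, ht⟩ := (IsNoetherian.noetherian Lᗮ : Lᗮ.FG)
  refine ⟨t ∪ t.image Neg.neg, ?_⟩
  ext x
  have h1 : x ∈ cone (t ∪ t.image Neg.neg) ↔ ∀ a ∈ t, ⟪a, x⟫_ℝ = 0 := by
    simp only [mem_cone, Finset.mem_union, Finset.mem_image]
    constructor
    · intro h a ha
      have h2 := h (-a) (Or.inr ⟨a, ha, rfl⟩)
      rw [inner_neg_left, neg_nonneg] at h2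
      exact le_antisymm h2 (h a (Or.inl ha))
    · rintro h a (ha | ⟨b, hb, rfl⟩)
      · exact (h a ha).ge
      · rw [inner_neg_left, h b hb, neg_zero]
  rw [h1, SetLike.mem_coe, ← orthogonal_orthogonal L, ← ht, mem_orthogonal]
  constructor
  · intro h v hv
    have : span ℝ (t : Set (E d)) ≤ (ℝ ∙ x)ᗮ := span_le.2 fun a ha =>
      mem_orthogonal_singleton_iff_inner_left.2 (h a ha)
    exact mem_orthogonal_singleton_iff_inner_left.1 (this hv)
  · exact fun h a ha => h a (subset_span ha)

/-- A subspace has itself as its only nonempty face, so every point projects into a face of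
dimension dim L. -/
theorem projRegion_submodule (k : ℕ) (L : Submodule ℝ (E d)) :
    projRegion k (L : Set (E d)) = if finrank ℝ L = k then Set.univ else ∅ := by
  obtain ⟨s, hs⟩ := exists_cone_eq L
  have hmem : ∀ x, x ∈ cone s ↔ x ∈ L := fun x => by rw [hs]; rfl
  have hact : ∀ y ∈ cone s, actSpan s y = L := by
    intro y hy
    ext v
    constructor
    · intro hv
      obtain ⟨ε, hε, h1, -⟩ := exists_add_mem_cone hy hv
      rw [hmem] at h1 hy
      exact (smul_mem_iff _ hε.ne').1 ((Submodule.add_mem_iff_right L hy).1 h1)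
    · intro hv
      refine mem_actSpan.2 fun a ha _ => ?_
      have h1 := (hmem v).2 hv a ha
      have h2 := (hmem (-v)).2 (neg_mem hv) a ha
      rw [inner_neg_right, neg_nonneg] at h2
      exact le_antisymm h2 h1
  ext x
  rw [← hs, mem_projRegion_cone]
  obtain ⟨y, hy⟩ := exists_isNearest s x
  constructor
  · rintro ⟨z, hz, hk⟩
    rw [hact z hz.1] at hk
    simp [hk]
  · intro h
    have hk : finrank ℝ L = k := by
      by_contra hne
      simp [hne] at h
    exact ⟨y, hy, by rw [hact y hy.1, hk]⟩

theorem coneVol_submodule (k : ℕ) (L : Submodule ℝ (E d)) :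
    coneVol k (L : Set (E d)) = if finrank ℝ L = k then 1 else 0 := by
  rw [coneVol, projRegion_submodule]
  split_ifs
  · rw [Set.univ_inter, div_self]
    exact (ENNReal.toReal_pos (Metric.measure_closedBall_pos _ _ one_pos).ne'
      measure_closedBall_lt_top.ne).ne'
  · simp

theorem genericVal_submodule {M : Type*} [AddCommGroup M] (g : Fin (d + 1) → M)
    (L : Submodule ℝ (E d)) (k : Fin (d + 1)) (hk : finrank ℝ L = k) :
    genericVal g (L : Set (E d)) = g k := by
  rw [genericVal, Finset.sum_eq_single k]
  · rw [projRegion_submodule, if_pos hk]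
    simp
  · intro j _ hj
    have hne : (k : ℕ) ≠ j := fun h => hj (Fin.ext h.symm)
    simp only [projRegion_submodule, hk, hne, if_false, Set.mem_empty_iff_false,
      eventually_false_iff_eq_bot, (Ultrafilter.neBot _).ne]
  · simp

/-! ### Invariance under isometries -/

theorem image_cone (r : E d ≃ₗᵢ[ℝ] E d) (s : Finset (E d)) :
    r '' cone s = cone (s.image r) := by
  ext x
  rw [LinearIsometryEquiv.image_eq_preimage_symm, Set.mem_preimage, mem_cone, mem_cone,
    Finset.forall_mem_image]
  refine forall₂_congr fun a _ => ?_
  rw [← r.inner_map_map a, r.apply_symm_apply]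

theorem actSpan_image (r : E d ≃ₗᵢ[ℝ] E d) (s : Finset (E d)) (y : E d) :
    actSpan (s.image r) (r y) = (actSpan s y).map (r.toLinearEquiv : E d →ₗ[ℝ] E d) := by
  ext v
  rw [mem_map_equiv]
  simp only [mem_actSpan, Finset.forall_mem_image, r.inner_map_map]
  refine forall₂_congr fun a _ => ?_
  change _ ↔ (_ → ⟪a, r.symm v⟫_ℝ = 0)
  rw [← r.inner_map_map a (r.symm v), r.apply_symm_apply]

theorem image_projRegion_cone (r : E d ≃ₗᵢ[ℝ] E d) (k : ℕ) (s : Finset (E d)) :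
    r '' projRegion k (cone s) = projRegion k (r '' cone s) := by
  have key : ∀ (r : E d ≃ₗᵢ[ℝ] E d) (s : Finset (E d)),
      r '' projRegion k (cone s) ⊆ projRegion k (r '' cone s) := by
    rintro r s _ ⟨x, hx, rfl⟩
    obtain ⟨y, hy, hk⟩ := mem_projRegion_cone.1 hx
    rw [image_cone, mem_projRegion_cone, ← image_cone]
    refine ⟨r y, ⟨⟨y, hy.1, rfl⟩, ?_⟩, ?_⟩
    · rintro _ ⟨z, hz, rfl⟩
      rw [← map_sub, ← map_sub, r.norm_map, r.norm_map]
      exact hy.2 z hz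
    · rw [actSpan_image, LinearEquiv.finrank_map_eq, hk]
  refine (key r s).antisymm fun x hx => ?_
  rw [image_cone] at hx
  have h := key r.symm (s.image r) ⟨x, hx, rfl⟩
  rw [← image_cone, ← Set.image_comp] at h
  simp only [Function.comp_def, r.symm_apply_apply, Set.image_id'] at h
  exact ⟨r.symm x, h, r.apply_symm_apply x⟩

theorem coneVol_image (r : E d ≃ₗᵢ[ℝ] E d) (k : ℕ) (s : Finset (E d)) :
    coneVol k (r '' cone s) = coneVol k (cone s) := by
  have hball : Metric.closedBall (0 : E d) 1 = r '' Metric.closedBall 0 1 := by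
    rw [r.image_closedBall, map_zero]
  rw [coneVol, coneVol, ← image_projRegion_cone]
  congr 1
  conv_lhs => rw [hball]
  rw [← Set.image_inter r.injective, LinearIsometryEquiv.image_eq_preimage_symm,
    r.symm.measurePreserving.measureReal_preimage
      ((measurableSet_projRegion k s).inter measurableSet_closedBall).nullMeasurableSet]

theorem isRotationInvariant_fanVol (k : ℕ) : IsRotationInvariant (d := d) (fanVol k) := by
  intro r _ N hN
  rw [fanVol, fanVol, finsum_mem_image r.injective.image_injective.injOn]
  refine finsum_mem_congr rfl fun C hC => ?_
  obtain ⟨s, rfl⟩ := hN.polyhedral C hC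
  exact coneVol_image r k s

/-! ### Fans of arrangements given by normal vectors -/

/-- The points of `L` on none of the hyperplanes with normals in `t`. -/
def offHyps (L : Submodule ℝ (E d)) (t : Finset (E d)) : Set (E d) :=
  {x | x ∈ L ∧ ∀ a ∈ t, ⟪a, x⟫_ℝ ≠ 0}

/-- The closed chamber containing `x`. -/
def chamber (L : Submodule ℝ (E d)) (t : Finset (E d)) (x : E d) : Set (E d) :=
  {z | z ∈ L ∧ ∀ a ∈ t, 0 ≤ ⟪a, x⟫_ℝ * ⟪a, z⟫_ℝ}

/-- The open chamber containing `x`. -/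
def openChamber (L : Submodule ℝ (E d)) (t : Finset (E d)) (x : E d) : Set (E d) :=
  {z | z ∈ L ∧ ∀ a ∈ t, 0 < ⟪a, x⟫_ℝ * ⟪a, z⟫_ℝ}

/-- The collection of all closed chambers. -/
def chambers (L : Submodule ℝ (E d)) (t : Finset (E d)) : Set (Set (E d)) :=
  chamber L t '' offHyps L t

variable {L : Submodule ℝ (E d)} {t : Finset (E d)} {x y : E d}

theorem mem_openChamber_self (hx : x ∈ offHyps L t) : x ∈ openChamber L t x :=
  ⟨hx.1, fun a ha => mul_self_pos.2 (hx.2 a ha)⟩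

theorem openChamber_subset_chamber : openChamber L t x ⊆ chamber L t x :=
  fun _ hz => ⟨hz.1, fun a ha => (hz.2 a ha).le⟩

theorem openChamber_subset_offHyps : openChamber L t x ⊆ offHyps L t :=
  fun _ hz => ⟨hz.1, fun a ha h => by simpa [h] using hz.2 a ha⟩

/-- By the intermediate value theorem no normal changes sign on a component. Conversely, the set
with a fixed sign pattern is convex. -/
theorem connectedComponentIn_offHyps (hx : x ∈ offHyps L t) :
    connectedComponentIn (offHyps L t) x = openChamber L t x := by
  apply Set.Subset.antisymm
  · intro z hz
    have hzL := connectedComponentIn_subset _ _ hz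
    have hxc := mem_connectedComponentIn hx
    refine ⟨hzL.1, fun a ha => ?_⟩
    have hno : ∀ w ∈ connectedComponentIn (offHyps L t) x, ⟪a, w⟫_ℝ ≠ 0 := fun w hw =>
      (connectedComponentIn_subset _ _ hw).2 a ha
    have hpre : IsPreconnected (connectedComponentIn (offHyps L t) x) :=
      isPreconnected_connectedComponentIn
    have hcont : ContinuousOn (fun w => ⟪a, w⟫_ℝ) (connectedComponentIn (offHyps L t) x) :=
      Continuous.continuousOn (by fun_prop)
    by_contra hneg
    rcases (hno x hxc).lt_or_gt with h1 | h1 <;> rcases (hno z hz).lt_or_gt with h2 | h2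
    · exact hneg (mul_pos_of_neg_of_neg h1 h2)
    · obtain ⟨w, hw, hw0⟩ := hpre.intermediate_value hxc hz hcont ⟨h1.le, h2.le⟩
      exact hno w hw hw0
    · obtain ⟨w, hw, hw0⟩ := hpre.intermediate_value hz hxc hcont ⟨h2.le, h1.le⟩
      exact hno w hw hw0
    · exact hneg (mul_pos h1 h2)
  · refine IsPreconnected.subset_connectedComponentIn ?_ (mem_openChamber_self hx)
      openChamber_subset_offHyps
    refine Convex.isPreconnected ?_
    intro y hy z hz a b ha hb hab
    refine ⟨add_mem (smul_mem _ _ hy.1) (smul_mem _ _ hz.1), fun c hc => ?_⟩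
    rw [inner_add_right, inner_smul_right, inner_smul_right]
    have h1 := hy.2 c hc
    have h2 := hz.2 c hc
    rw [show ⟪c, x⟫_ℝ * (a * ⟪c, y⟫_ℝ + b * ⟪c, z⟫_ℝ) =
      a * (⟪c, x⟫_ℝ * ⟪c, y⟫_ℝ) + b * (⟪c, x⟫_ℝ * ⟪c, z⟫_ℝ) by ring]
    rcases ha.eq_or_lt with rfl | ha
    · rw [zero_add] at hab
      simpa [hab] using h2
    · exact add_pos_of_pos_of_nonneg (mul_pos ha h1) (mul_nonneg hb h2.le)

theorem isClosed_chamber : IsClosed (chamber L t x) := by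
  have : chamber L t x = (L : Set (E d)) ∩ ⋂ a ∈ t, {z | 0 ≤ ⟪a, x⟫_ℝ * ⟪a, z⟫_ℝ} := by
    ext z; simp [chamber]
  rw [this]
  exact L.closed_of_finiteDimensional.inter
    (isClosed_biInter fun a _ => isClosed_le continuous_const (by fun_prop))

theorem closure_openChamber (hx : x ∈ offHyps L t) :
    closure (openChamber L t x) = chamber L t x := by
  refine (closure_minimal openChamber_subset_chamber isClosed_chamber).antisymm fun z hz => ?_
  have h1 : Tendsto (fun r : ℝ => z + r • x) (𝓝[>] 0) (𝓝 z) := by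
    have : Continuous fun r : ℝ => z + r • x := by fun_prop
    simpa using (this.tendsto 0).mono_left nhdsWithin_le_nhds
  refine mem_closure_of_tendsto h1 ?_
  filter_upwards [self_mem_nhdsWithin] with r hr
  refine ⟨add_mem hz.1 (smul_mem _ _ hx.1), fun a ha => ?_⟩
  rw [inner_add_right, inner_smul_right, mul_add, mul_left_comm]
  exact add_pos_of_nonneg_of_pos (hz.2 a ha) (mul_pos hr (mul_self_pos.2 (hx.2 a ha)))

/-- Two chambers sharing an interior point agree. -/
theorem chamber_eq_of_mem (hy : y ∈ openChamber L t x) : chamber L t y = chamber L t x := by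
  ext z
  refine and_congr_right fun _ => forall₂_congr fun a ha => ?_
  have h := hy.2 a ha
  rcases pos_and_pos_or_neg_and_neg_of_mul_pos h with ⟨h1, h2⟩ | ⟨h1, h2⟩
  · rw [mul_nonneg_iff_of_pos_left h1, mul_nonneg_iff_of_pos_left h2]
  · rw [← neg_mul_neg, mul_nonneg_iff_of_pos_left (neg_pos.2 h2), ← neg_mul_neg,
      mul_nonneg_iff_of_pos_left (neg_pos.2 h1)]

theorem exists_add_mem_openChamber (hy : y ∈ openChamber L t x) {v : E d} (hv : v ∈ L) :
    ∃ ε : ℝ, 0 < ε ∧ y + ε • v ∈ openChamber L t x ∧ y - ε • v ∈ openChamber L t x := by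
  have hev : ∀ᶠ z in 𝓝 y, z ∈ L → z ∈ openChamber L t x := by
    filter_upwards [eventually_inner_pos (t.image fun a => ⟪a, x⟫_ℝ • a) y] with z hz hzL
    refine ⟨hzL, fun a ha => ?_⟩
    have := hz _ (Finset.mem_image_of_mem _ ha)
    simp only [real_inner_smul_left] at this
    exact this (hy.2 a ha)
  obtain ⟨ε, hε, h1, h2⟩ := exists_add_smul_of_eventually hev v
  exact ⟨ε, hε, h1 (add_mem hy.1 (smul_mem _ _ hv)), h2 (sub_mem hy.1 (smul_mem _ _ hv))⟩

theorem span_chamber (hx : x ∈ offHyps L t) : span ℝ (chamber L t x) = L := by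
  refine le_antisymm (span_le.2 fun z hz => hz.1) fun v hv => ?_
  obtain ⟨ε, hε, h1, -⟩ := exists_add_mem_openChamber (mem_openChamber_self hx) hv
  have := sub_mem (subset_span (R := ℝ) (openChamber_subset_chamber h1))
    (subset_span (openChamber_subset_chamber (mem_openChamber_self hx)))
  rw [add_sub_cancel_left] at this
  exact (smul_mem_iff _ hε.ne').1 this

theorem zero_mem_chamber : (0 : E d) ∈ chamber L t x := ⟨zero_mem _, fun a _ => by simp⟩

theorem intrinsicInterior_chamber (hx : x ∈ offHyps L t) :
    intrinsicInterior ℝ (chamber L t x) = openChamber L t x := by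
  ext y
  constructor
  · intro hy
    obtain ⟨ε, hε, -, h2⟩ := exists_extend_of_mem_intrinsicInterior zero_mem_chamber hy
      (subset_span (openChamber_subset_chamber (mem_openChamber_self hx)))
    refine ⟨(intrinsicInterior_subset hy).1, fun a ha => ?_⟩
    have h3 := h2.2 a ha
    rw [inner_sub_right, inner_smul_right, mul_sub, mul_left_comm, sub_nonneg] at h3
    exact (mul_pos hε (mul_self_pos.2 (hx.2 a ha))).trans_le h3
  · intro hy
    rw [mem_intrinsicInterior_iff_of_zero_mem zero_mem_chamber, span_chamber hx]
    refine ⟨openChamber_subset_chamber hy, ?_⟩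
    obtain ⟨ε, hε, h⟩ := Metric.eventually_nhds_iff.1
      (eventually_inner_pos (t.image fun a => ⟪a, x⟫_ℝ • a) y)
    refine ⟨ε, hε, fun z hz hd => ⟨hz, fun a ha => ?_⟩⟩
    have := h hd _ (Finset.mem_image_of_mem _ ha)
    simp only [real_inner_smul_left] at this
    exact (this (hy.2 a ha)).le

theorem chamber_eq_cone (s : Finset (E d)) (hs : cone s = L) :
    chamber L t x = cone (s ∪ t.image fun a => ⟪a, x⟫_ℝ • a) := by
  ext z
  have : z ∈ L ↔ ∀ a ∈ s, 0 ≤ ⟪a, z⟫_ℝ := by rw [← SetLike.mem_coe, ← hs]; rfl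
  simp only [chamber, Set.mem_ofPred_eq, mem_cone, Finset.mem_union, or_imp, forall_and,
    Finset.forall_mem_image, real_inner_smul_left, this]

theorem isFan_chambers (L : Submodule ℝ (E d)) (t : Finset (E d)) : IsFan (chambers L t) where
  finite := by
    -- A chamber depends only on the set P of normals positive at its base point.
    refine (t.powerset.finite_toSet.image fun P =>
      {z | z ∈ L ∧ ∀ a ∈ t, if a ∈ P then 0 ≤ ⟪a, z⟫_ℝ else ⟪a, z⟫_ℝ ≤ 0}).subset ?_
    rintro _ ⟨x, hx, rfl⟩
    refine ⟨t.filter fun a => 0 < ⟪a, x⟫_ℝ,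
      Finset.mem_coe.2 (Finset.mem_powerset.2 (Finset.filter_subset _ _)), ?_⟩
    ext z
    refine and_congr_right fun _ => forall₂_congr fun a ha => ?_
    rcases (hx.2 a ha).lt_or_gt with h | h
    · rw [if_neg (by simp [ha, h.le])]
      exact ⟨fun h' => mul_nonneg_of_nonpos_of_nonpos h.le h',
        fun h' => nonpos_of_mul_nonneg_right h' h⟩
    · rw [if_pos (by simp [ha, h]), mul_nonneg_iff_of_pos_left h]
  polyhedral := by
    rintro _ ⟨x, hx, rfl⟩
    obtain ⟨s, hs⟩ := exists_cone_eq L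
    rw [chamber_eq_cone s hs]
    exact isPolyhedralCone_cone _
  face := by
    rintro _ ⟨x, hx, rfl⟩ _ ⟨y, hy, rfl⟩
    obtain ⟨s, hs⟩ := exists_cone_eq L
    -- Two chambers meet in the face on which all hyperplanes separating x from y vanish.
    have hsub : ((t.filter fun a => ⟪a, x⟫_ℝ * ⟪a, y⟫_ℝ < 0).image fun a => ⟪a, x⟫_ℝ • a) ⊆
        s ∪ t.image fun a => ⟪a, x⟫_ℝ • a :=
      (Finset.image_subset_image (Finset.filter_subset _ _)).trans Finset.subset_union_right
    have := isExposed_cone_inter_ann hsub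
    rw [← chamber_eq_cone s hs] at this
    convert this using 1
    ext z
    refine and_congr_right fun hz => ?_
    simp only [SetLike.mem_coe, mem_ann, Finset.forall_mem_image, Finset.mem_filter,
      real_inner_smul_left]
    constructor
    · rintro hz' a ⟨ha, hneg⟩
      have h1 := hz.2 a ha
      have h2 := hz'.2 a ha
      rcases mul_neg_iff.1 hneg with ⟨h3, h4⟩ | ⟨h3, h4⟩
      · have h5 := nonneg_of_mul_nonneg_right h1 h3
        have h6 := nonpos_of_mul_nonneg_right h2 h4
        rw [le_antisymm h6 h5, mul_zero]
      · have h5 := nonpos_of_mul_nonneg_right h1 h3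
        have h6 := nonneg_of_mul_nonneg_right h2 h4
        rw [le_antisymm h5 h6, mul_zero]
    · intro h
      refine ⟨hz.1, fun a ha => ?_⟩
      by_cases hneg : ⟪a, x⟫_ℝ * ⟪a, y⟫_ℝ < 0
      · have := h ⟨ha, hneg⟩
        rw [(mul_eq_zero.1 this).resolve_left (hx.2 a ha), mul_zero]
      · have h1 := hz.2 a ha
        have h2 := not_lt.1 hneg
        rcases (hx.2 a ha).lt_or_gt with h3 | h3
        · exact mul_nonneg_of_nonpos_of_nonpos (nonpos_of_mul_nonneg_right h2 h3)
            (nonpos_of_mul_nonneg_right h1 h3)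
        · exact mul_nonneg (nonneg_of_mul_nonneg_right h2 h3) (nonneg_of_mul_nonneg_right h1 h3)
  lin_eq := by
    rintro _ ⟨x, hx, rfl⟩ _ ⟨y, hy, rfl⟩
    rw [span_chamber hx, span_chamber hy]

theorem lin_chambers (h : (offHyps L t).Nonempty) : lin (chambers L t) = L := by
  obtain ⟨x, hx⟩ := h
  rw [← span_eq_lin (isFan_chambers L t) ⟨x, hx, rfl⟩, span_chamber hx]

/-! ### Cutting the fan of an arrangement -/

theorem mem_offHyps_insert {u : E d} :
    x ∈ offHyps L (insert u t) ↔ ⟪u, x⟫_ℝ ≠ 0 ∧ x ∈ offHyps L t := by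
  simp only [offHyps, Set.mem_ofPred_eq, Finset.forall_mem_insert]
  tauto

theorem chamber_insert {u : E d} :
    chamber L (insert u t) x = chamber L t x ∩ {z | 0 ≤ ⟪u, x⟫_ℝ * ⟪u, z⟫_ℝ} := by
  ext z
  simp only [chamber, Set.mem_ofPred_eq, Finset.forall_mem_insert, Set.mem_inter_iff]
  tauto

theorem chambers_insert_neg {u : E d} :
    chambers L (insert (-u) t) = chambers L (insert u t) := by
  have h1 : offHyps L (insert (-u) t) = offHyps L (insert u t) := by
    ext x; simp [mem_offHyps_insert]
  have h2 : chamber L (insert (-u) t) = chamber L (insert u t) := by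
    ext x z; simp [chamber_insert]
  rw [chambers, chambers, h1, h2]

theorem cut_chambers (S : Set (E d)) : cut (chambers L t) S =
    {C | ∃ x ∈ offHyps L t, x ∈ S ∧ C = chamber L t x ∩ S} := by
  ext C
  constructor
  · rintro ⟨_, ⟨⟨x, hx, rfl⟩, y, hy, hyS⟩, rfl⟩
    rw [intrinsicInterior_chamber hx] at hy
    exact ⟨y, openChamber_subset_offHyps hy, hyS, by rw [chamber_eq_of_mem hy]⟩
  · rintro ⟨x, hx, hxS, rfl⟩
    refine ⟨_, ⟨⟨x, hx, rfl⟩, x, ?_, hxS⟩, rfl⟩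
    rw [intrinsicInterior_chamber hx]
    exact mem_openChamber_self hx

theorem chamber_insert_of_neg {u : E d} (h : ⟪u, x⟫_ℝ < 0) :
    chamber L (insert u t) x = chamber L t x ∩ {z | z ∈ L ∧ ⟪u, z⟫_ℝ ≤ 0} := by
  rw [chamber_insert]
  ext z
  refine and_congr_right fun hz => ⟨fun h' => ⟨hz.1, nonpos_of_mul_nonneg_right h' h⟩,
    fun h' => mul_nonneg_of_nonpos_of_nonpos h.le h'.2⟩

/-- Inside the halfspace, adding the hyperplane of u changes no piece. A base point lying on it is
pushed off to x - ε u without leaving its open chamber for t. -/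
theorem cut_chambers_nonpos {u : E d} (hu : u ∈ L) (hu0 : u ≠ 0) :
    cut (chambers L (insert u t)) {z | z ∈ L ∧ ⟪u, z⟫_ℝ ≤ 0} =
      cut (chambers L t) {z | z ∈ L ∧ ⟪u, z⟫_ℝ ≤ 0} := by
  rw [cut_chambers, cut_chambers]
  ext C
  constructor
  · rintro ⟨x, hx, hxS, rfl⟩
    rw [mem_offHyps_insert] at hx
    refine ⟨x, hx.2, hxS, ?_⟩
    rw [chamber_insert_of_neg (lt_of_le_of_ne hxS.2 hx.1), Set.inter_assoc, Set.inter_self]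
  · rintro ⟨x, hx, hxS, rfl⟩
    obtain ⟨ε, hε, -, hy⟩ := exists_add_mem_openChamber (mem_openChamber_self hx) hu
    have hneg : ⟪u, x - ε • u⟫_ℝ < 0 := by
      rw [inner_sub_right, inner_smul_right]
      have := mul_pos hε (real_inner_self_pos.2 hu0)
      linarith [hxS.2]
    refine ⟨x - ε • u, mem_offHyps_insert.2 ⟨hneg.ne, openChamber_subset_offHyps hy⟩,
      ⟨hy.1, hneg.le⟩, ?_⟩
    rw [chamber_insert_of_neg hneg, Set.inter_assoc, Set.inter_self, chamber_eq_of_mem hy]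

theorem cut_chambers_nonneg {u : E d} (hu : u ∈ L) (hu0 : u ≠ 0) :
    cut (chambers L (insert u t)) {z | z ∈ L ∧ 0 ≤ ⟪u, z⟫_ℝ} =
      cut (chambers L t) {z | z ∈ L ∧ 0 ≤ ⟪u, z⟫_ℝ} := by
  have := cut_chambers_nonpos (t := t) (neg_mem hu) (neg_ne_zero.2 hu0)
  rw [chambers_insert_neg] at this
  simpa only [inner_neg_left, neg_nonpos] using this

theorem cut_chambers_insert_eq_zero {u : E d} :
    cut (chambers L (insert u t)) {z | z ∈ L ∧ ⟪u, z⟫_ℝ = 0} = ∅ := by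
  rw [cut_chambers, Set.eq_empty_iff_forall_notMem]
  rintro C ⟨x, hx, hxS, -⟩
  exact (mem_offHyps_insert.1 hx).1 hxS.2

theorem cut_chambers_eq_zero {u : E d} :
    cut (chambers L t) {z | z ∈ L ∧ ⟪u, z⟫_ℝ = 0} = chambers (L ⊓ ann {u}) t := by
  have hch : ∀ x, chamber L t x ∩ {z | z ∈ L ∧ ⟪u, z⟫_ℝ = 0} = chamber (L ⊓ ann {u}) t x := by
    intro x
    ext z
    simp only [chamber, Set.mem_inter_iff, Set.mem_ofPred_eq, mem_inf, mem_ann_singleton]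
    tauto
  rw [cut_chambers]
  ext C
  simp only [hch]
  constructor
  · rintro ⟨x, hx, hxS, rfl⟩
    exact ⟨x, ⟨⟨hx.1, mem_ann_singleton.2 hxS.2⟩, hx.2⟩, rfl⟩
  · rintro ⟨x, hx, rfl⟩
    exact ⟨x, ⟨hx.1.1, hx.2⟩, ⟨hx.1.1, mem_ann_singleton.1 hx.1.2⟩, rfl⟩

theorem IsFanValuation.map_chambers_insert {G : Type*} [AddCommGroup G]
    {φ : Set (Set (E d)) → G} (hφ : IsFanValuation φ) {u : E d} (hu : u ∈ L) (hu0 : u ≠ 0)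
    (hne : (offHyps L (insert u t)).Nonempty) :
    φ (chambers L (insert u t)) = φ (chambers L t) + φ (chambers (L ⊓ ann {u}) t) := by
  have h1 := hφ.map_cut _ (isFan_chambers L (insert u t)) u
    (by rw [lin_chambers hne]; exact hu) hu0
  have hne' : (offHyps L t).Nonempty := hne.mono fun x hx => (mem_offHyps_insert.1 hx).2
  have h2 := hφ.map_cut _ (isFan_chambers L t) u (by rw [lin_chambers hne']; exact hu) hu0
  rw [lin_chambers hne, cut_chambers_nonpos hu hu0, cut_chambers_nonneg hu hu0,
    cut_chambers_insert_eq_zero, hφ.map_empty, sub_zero] at h1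
  rw [lin_chambers hne', cut_chambers_eq_zero] at h2
  rw [h1, h2, sub_add_cancel]

namespace Arrangement

theorem fan_eq_chambers {A : Arrangement d} (h : A.complement = offHyps L t) :
    A.fan = chambers L t := by
  rw [fan, chambers, h]
  refine Set.image_congr fun x hx => ?_
  rw [connectedComponentIn_offHyps hx, closure_openChamber hx]

theorem exists_normal (A : Arrangement d) {H : Submodule ℝ (E d)} (hH : H ∈ A.hyps) :
    ∃ u ∈ A.ambient, u ≠ 0 ∧ A.ambient ⊓ ann {u} = H := by
  have hle := A.le_ambient H hH
  have hrk := A.codim_one H hH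
  have hlt : H < A.ambient := lt_of_le_of_ne hle fun h => by rw [h] at hrk; omega
  have hne : Hᗮ ⊓ A.ambient ≠ ⊥ := fun h => by
    have h2 := sup_orthogonal_inf_of_hasOrthogonalProjection hle
    rw [h, sup_bot_eq] at h2
    exact hlt.ne h2
  obtain ⟨u, hu, hu0⟩ := exists_mem_ne_zero_of_ne_bot hne
  refine ⟨u, hu.2, hu0, ?_⟩
  have h1 : H ≤ A.ambient ⊓ ann {u} := le_inf hle fun v hv => mem_ann_singleton.2 (by
    rw [real_inner_comm]; exact (mem_orthogonal _ _).1 hu.1 v hv)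
  have h2 : A.ambient ⊓ ann {u} < A.ambient := lt_of_le_of_ne inf_le_left fun h => by
    have : u ∈ A.ambient ⊓ ann {u} := h.symm ▸ hu.2
    exact hu0 (inner_self_eq_zero.1 (mem_ann_singleton.1 this.2))
  have h3 := finrank_lt_finrank_of_lt h2
  have h4 := finrank_mono h1
  exact (eq_of_le_of_finrank_eq h1 (by omega)).symm

/-- A real vector space is not a finite union of proper subspaces. -/
theorem nonempty_complement (A : Arrangement d) : A.complement.Nonempty := by
  by_contra hne
  rw [Set.not_nonempty_iff_eq_empty] at hne
  have := Subspace.top_mem_of_biUnion_eq_univ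
    (s := A.hyps.image fun H => H.comap A.ambient.subtype) (by
      rw [Set.eq_univ_iff_forall]
      intro x
      have hx : (x : E d) ∉ A.complement := by rw [hne]; exact Set.notMem_empty _
      simp only [complement, Set.mem_ofPred_eq, x.2, true_and, not_forall, not_not] at hx
      obtain ⟨H, hH, hxH⟩ := hx
      exact Set.mem_biUnion (Finset.mem_coe.2 (Finset.mem_image_of_mem _ hH)) hxH)
  obtain ⟨H, hH, h⟩ := Finset.mem_image.1 this
  have hle := comap_subtype_eq_top.1 h
  have := A.codim_one H hH
  have := finrank_mono hle
  omega

theorem fan_of_hyps_eq_empty {A : Arrangement d} (h : A.hyps = ∅) :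
    A.fan = {(A.ambient : Set (E d))} := by
  have hc : A.complement = offHyps A.ambient ∅ := by simp [complement, h, offHyps]
  rw [fan_eq_chambers hc, chambers]
  ext C
  simp only [chamber, offHyps, Set.mem_image, Set.mem_singleton_iff, Finset.notMem_empty,
    false_imp_iff, implies_true, and_true, Set.mem_ofPred_eq]
  exact ⟨fun ⟨x, _, hx⟩ => hx.symm, fun hC => ⟨0, zero_mem _, hC.symm⟩⟩

end Arrangement

theorem IsFanValuation.map_fan {G : Type*} [AddCommGroup G] {φ : Set (Set (E d)) → G}
    (hφ : IsFanValuation φ) (A : Arrangement d) {H : Submodule ℝ (E d)} (hH : H ∈ A.hyps) :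
    φ A.fan = φ (A.delete H).fan + φ (A.restrict H hH).fan := by
  choose! n hn using fun K (hK : K ∈ A.hyps) => A.exists_normal hK
  have hmem : ∀ K ∈ A.hyps, ∀ x ∈ A.ambient, x ∈ K ↔ ⟪n K, x⟫_ℝ = 0 := by
    intro K hK x hx
    conv_lhs => rw [← (hn K hK).2.2]
    rw [mem_inf, mem_ann_singleton, and_iff_right hx]
  set t := (A.hyps.erase H).image n with ht
  have hins : A.hyps.image n = insert (n H) t := by
    rw [ht, ← Finset.image_insert, Finset.insert_erase hH]
  have h1 : A.complement = offHyps A.ambient (insert (n H) t) := by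
    rw [← hins]
    ext x
    refine and_congr_right fun hx => ?_
    rw [Finset.forall_mem_image]
    exact forall₂_congr fun K hK => not_congr (hmem K hK x hx)
  have h2 : (A.delete H).complement = offHyps A.ambient t := by
    ext x
    refine and_congr_right fun hx => ?_
    rw [ht, Finset.forall_mem_image]
    exact forall₂_congr fun K hK => not_congr (hmem K (Finset.mem_of_mem_erase hK) x hx)
  -- `offHyps` does not require normals to lie in the subspace, so the same vector `n K` cuts out K
  -- ⊓ H in H. Coinciding restrictions are harmless because only the complement matters.
  have h3 : (A.restrict H hH).complement = offHyps (A.ambient ⊓ ann {n H}) t := by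
    rw [(hn H hH).2.2]
    ext x
    refine and_congr_right fun (hx : x ∈ H) => ?_
    rw [ht, Finset.forall_mem_image]
    change (∀ K ∈ (A.hyps.erase H).image (fun K => K ⊓ H), x ∉ K) ↔ _
    rw [Finset.forall_mem_image]
    refine forall₂_congr fun K hK => not_congr ?_
    rw [mem_inf, and_iff_left hx]
    exact hmem K (Finset.mem_of_mem_erase hK) x (A.le_ambient H hH hx)
  rw [Arrangement.fan_eq_chambers h1, Arrangement.fan_eq_chambers h2,
    Arrangement.fan_eq_chambers h3]
  exact hφ.map_chambers_insert (hn H hH).1 (hn H hH).2.1 (h1 ▸ A.nonempty_complement)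

/-! ### Whitney numbers -/

theorem sum_powerset_card_insert {γ : Type*} [DecidableEq γ] {s : Finset γ} {b : γ} (hb : b ∉ s)
    (h : Finset γ → ℤ) : ∑ B ∈ s.powerset, (-1) ^ (insert b B).card * h B =
      -∑ B ∈ s.powerset, (-1) ^ B.card * h B := by
  rw [← Finset.sum_neg_distrib]
  refine Finset.sum_congr rfl fun B hB => ?_
  rw [Finset.card_insert_of_notMem fun hb' => hb (Finset.mem_powerset.1 hB hb'), pow_succ]
  ring

/-- Signed subset sums do not see repetitions. This is needed because distinct hyperplanes may have
the same intersection with H. -/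
theorem sum_powerset_image_neg_one_pow {α β : Type*} [DecidableEq α] [DecidableEq β] (f : α → β) (t : Finset α)
    (g : Finset β → ℤ) :
    ∑ B ∈ t.powerset, (-1) ^ B.card * g (B.image f) =
      ∑ B ∈ (t.image f).powerset, (-1) ^ B.card * g B := by
  induction t using Finset.induction_on generalizing g with
  | empty => simp
  | insert a t ha ih =>
    rw [Finset.sum_powerset_insert ha]
    simp only [Finset.image_insert]
    rw [sum_powerset_card_insert ha fun B => g (insert (f a) (B.image f)), ih g,
      ih fun B => g (insert (f a) B)]
    by_cases hfa : f a ∈ t.image f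
    · rw [Finset.insert_eq_of_mem hfa]
      -- Sets with and without `f a` pair off with opposite signs.
      have h0 : ∑ B ∈ (t.image f).powerset, (-1) ^ B.card * g (insert (f a) B) = 0 := by
        rw [← Finset.insert_erase hfa, Finset.sum_powerset_insert (Finset.notMem_erase _ _)]
        simp only [Finset.insert_idem]
        rw [sum_powerset_card_insert (Finset.notMem_erase _ _) fun B => g (insert (f a) B), add_neg_cancel]
      rw [h0, neg_zero, add_zero]
    · rw [Finset.sum_powerset_insert hfa, sum_powerset_card_insert hfa fun B => g (insert (f a) B)]

/-- The alternating sum over subarrangements of a function of their intersection. -/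
noncomputable def altSum (L : Submodule ℝ (E d)) (t : Finset (Submodule ℝ (E d)))
    (g : Submodule ℝ (E d) → ℤ) : ℤ :=
  ∑ B ∈ t.powerset, (-1) ^ B.card * g (L ⊓ B.inf id)

theorem inf_inf_image_inf (H L : Submodule ℝ (E d)) (hH : H ≤ L)
    (B : Finset (Submodule ℝ (E d))) :
    H ⊓ (B.image fun K => K ⊓ H).inf id = L ⊓ (insert H B).inf id := by
  apply le_antisymm
  · refine le_inf (inf_le_left.trans hH) (Finset.le_inf fun K hK => ?_)
    rcases Finset.mem_insert.1 hK with rfl | hK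
    · exact inf_le_left
    · exact (inf_le_right.trans (Finset.inf_le (Finset.mem_image_of_mem _ hK))).trans inf_le_left
  · have hle : L ⊓ (insert H B).inf id ≤ H :=
      inf_le_right.trans (Finset.inf_le (Finset.mem_insert_self H B))
    refine le_inf hle (Finset.le_inf fun K hK => ?_)
    obtain ⟨K', hK', rfl⟩ := Finset.mem_image.1 hK
    exact le_inf (inf_le_right.trans (Finset.inf_le (Finset.mem_insert_of_mem hK'))) hle

theorem altSum_insert {H L : Submodule ℝ (E d)} (hH : H ≤ L) {t : Finset (Submodule ℝ (E d))}
    (ht : H ∉ t) (g : Submodule ℝ (E d) → ℤ) :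
    altSum L (insert H t) g = altSum L t g - altSum H (t.image fun K => K ⊓ H) g := by
  have h1 := sum_powerset_image_neg_one_pow (fun K => K ⊓ H) t fun B => g (H ⊓ B.inf id)
  have h2 := sum_powerset_card_insert ht fun B => g (L ⊓ (insert H B).inf id)
  simp only [inf_inf_image_inf H L hH] at h1
  rw [altSum, Finset.sum_powerset_insert ht, h2, h1]
  rfl

namespace Arrangement

theorem card_delete (A : Arrangement d) {H : Submodule ℝ (E d)} (hH : H ∈ A.hyps) :
    (A.delete H).hyps.card < A.hyps.card := Finset.card_erase_lt_of_mem hH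

theorem card_restrict (A : Arrangement d) {H : Submodule ℝ (E d)} (hH : H ∈ A.hyps) :
    (A.restrict H hH).hyps.card < A.hyps.card :=
  Finset.card_image_le.trans_lt (Finset.card_erase_lt_of_mem hH)

theorem delRestInduction {P : Arrangement d → Prop} (empty : ∀ A, A.hyps = ∅ → P A)
    (step : ∀ (A : Arrangement d) (H : Submodule ℝ (E d)) (hH : H ∈ A.hyps),
      P (A.delete H) → P (A.restrict H hH) → P A) (A : Arrangement d) : P A := by
  induction h : A.hyps.card using Nat.strong_induction_on generalizing A with
  | _ n ih =>
    subst h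
    rcases A.hyps.eq_empty_or_nonempty with h0 | ⟨H, hH⟩
    · exact empty A h0
    · exact step A H hH (ih _ (A.card_delete hH) _ rfl) (ih _ (A.card_restrict hH) _ rfl)

theorem altSum_eq (A : Arrangement d) {H : Submodule ℝ (E d)} (hH : H ∈ A.hyps)
    (g : Submodule ℝ (E d) → ℤ) :
    altSum A.ambient A.hyps g = altSum (A.delete H).ambient (A.delete H).hyps g -
      altSum (A.restrict H hH).ambient (A.restrict H hH).hyps g := by
  conv_lhs => rw [← Finset.insert_erase hH]
  exact altSum_insert (A.le_ambient H hH) (Finset.notMem_erase _ _) g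

/-- The Möbius function `μ(0̂, F)` as an alternating sum over subarrangements. -/
noncomputable def mob (A : Arrangement d) (F : Submodule ℝ (E d)) : ℤ :=
  altSum A.ambient A.hyps fun K => if K = F then 1 else 0

/-- In the recurrence for `mob` the restriction enters with a minus sign, and its ambient dimension
is one less. After normalization by the sign, both terms are nonnegative. -/
theorem mob_sign (A : Arrangement d) (F : Submodule ℝ (E d)) :
    0 ≤ (-1) ^ (finrank ℝ A.ambient + finrank ℝ F) * A.mob F := by
  induction A using delRestInduction with
  | empty A h =>
    have : A.mob F = if A.ambient = F then 1 else 0 := by simp [mob, altSum, h]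
    rw [this]
    split_ifs with hF
    · rw [hF, Even.neg_one_pow ⟨_, rfl⟩, mul_one]; norm_num
    · simp
  | step A H hH h1 h2 =>
    have hrk := A.codim_one H hH
    rw [mob, A.altSum_eq hH, mul_sub]
    change 0 ≤ (-1) ^ (finrank ℝ (A.delete H).ambient + finrank ℝ F) * (A.delete H).mob F -
      (-1) ^ (finrank ℝ A.ambient + finrank ℝ F) * (A.restrict H hH).mob F
    have h3 : (-1 : ℤ) ^ (finrank ℝ A.ambient + finrank ℝ F) =
        -(-1) ^ (finrank ℝ (A.restrict H hH).ambient + finrank ℝ F) := by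
      change _ = -(-1) ^ (finrank ℝ H + _)
      rw [← hrk, add_right_comm, pow_succ]; ring
    rw [h3]
    linarith

/-- The sum counts, with signs, all sets of hyperplanes containing F. It vanishes unless there are
none, that is, unless F is the ambient space. This is the recursion defining the Möbius function. -/
theorem sum_mob (A : Arrangement d) (F : A.FlatLattice) :
    ∑ K ∈ Finset.Icc A.bottomFlat F, A.mob (OrderDual.ofDual K).1 =
      if A.bottomFlat = F then 1 else 0 := by
  have hbot : ∀ K : A.FlatLattice, A.bottomFlat ≤ K := by
    intro K
    obtain ⟨B, -, hB⟩ := Finset.mem_image.1 (OrderDual.ofDual K).2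
    change (OrderDual.ofDual K).1 ≤ A.ambient
    rw [← hB]
    exact inf_le_left
  set F' := (OrderDual.ofDual F).1 with hF'
  have hIcc : Finset.Icc A.bottomFlat F = Finset.univ.filter (fun K => K ≤ F) := by
    ext K; simp [hbot K]
  have h1 : ∑ K ∈ Finset.Icc A.bottomFlat F, A.mob (OrderDual.ofDual K).1 =
      ∑ B ∈ A.hyps.powerset, (-1) ^ B.card * if F' ≤ A.ambient ⊓ B.inf id then 1 else 0 := by
    simp only [mob, altSum]
    rw [Finset.sum_comm]
    refine Finset.sum_congr rfl fun B hB => ?_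
    rw [← Finset.mul_sum]
    congr 1
    let K₀ : A.FlatLattice := OrderDual.toDual ⟨A.ambient ⊓ B.inf id,
      Finset.mem_image.2 ⟨B, hB, rfl⟩⟩
    rw [hIcc, Finset.sum_filter, Finset.sum_eq_single K₀]
    · rw [if_pos (show A.ambient ⊓ B.inf id = (OrderDual.ofDual K₀).1 from rfl)]
      rfl
    · intro K _ hK
      have : A.ambient ⊓ B.inf id ≠ (OrderDual.ofDual K).1 := fun h =>
        hK (Subtype.ext h.symm : OrderDual.ofDual K = OrderDual.ofDual K₀)
      rw [if_neg this, ite_self]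
    · simp
  have hFA : F' ≤ A.ambient := hbot F
  have h2 : ∀ B ∈ A.hyps.powerset, F' ≤ A.ambient ⊓ B.inf id ↔
      B ∈ (A.hyps.filter fun K => F' ≤ K).powerset := by
    intro B hB
    rw [le_inf_iff, Finset.le_inf_iff, and_iff_right hFA, Finset.mem_powerset,
      Finset.subset_iff]
    refine forall₂_congr fun K hK => ?_
    simp [Finset.mem_powerset.1 hB hK]
  rw [h1]
  have h3 : ∑ B ∈ A.hyps.powerset,
      (-1) ^ B.card * (if F' ≤ A.ambient ⊓ B.inf id then 1 else 0) =
      ∑ B ∈ (A.hyps.filter fun K => F' ≤ K).powerset, (-1 : ℤ) ^ B.card := by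
    simp only [mul_ite, mul_one, mul_zero]
    rw [← Finset.sum_filter]
    refine Finset.sum_congr ?_ fun _ _ => rfl
    ext B
    rw [Finset.mem_filter]
    constructor
    · rintro ⟨hB, h⟩
      exact (h2 B hB).1 h
    · intro hB
      have hB' := Finset.powerset_mono.2 (Finset.filter_subset _ _) hB
      exact ⟨hB', (h2 B hB').2 hB⟩
  rw [h3, Finset.sum_powerset_neg_one_pow_card]
  refine if_congr ?_ rfl rfl
  rw [Finset.filter_eq_empty_iff]
  constructor
  · intro h
    obtain ⟨B, hB, hBF⟩ := Finset.mem_image.1 (OrderDual.ofDual F).2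
    have hB0 : B = ∅ := by
      rw [Finset.eq_empty_iff_forall_notMem]
      intro K hK
      refine h (Finset.mem_powerset.1 hB hK) ?_
      rw [hF', ← hBF]
      exact inf_le_right.trans (Finset.inf_le hK)
    refine (Subtype.ext ?_ : OrderDual.ofDual A.bottomFlat = OrderDual.ofDual F)
    rw [← hBF, hB0, Finset.inf_empty, inf_top_eq]
    rfl
  · intro h K hK hle
    have : F' = A.ambient := by rw [hF', ← h]; rfl
    rw [this] at hle
    have := finrank_mono hle
    have := A.codim_one K hK
    omega

theorem mu_eq_mob (A : Arrangement d) (F : A.FlatLattice) :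
    (IncidenceAlgebra.mu ℤ : IncidenceAlgebra ℤ A.FlatLattice) A.bottomFlat F =
      A.mob (OrderDual.ofDual F).1 := by
  induction F using WellFoundedLT.induction with
  | _ F ih =>
    have h1 := IncidenceAlgebra.sum_Icc_mu_right (𝕜 := ℤ) A.bottomFlat F
    have h2 := A.sum_mob F
    have hle : A.bottomFlat ≤ F := by
      obtain ⟨B, -, hB⟩ := Finset.mem_image.1 (OrderDual.ofDual F).2
      change (OrderDual.ofDual F).1 ≤ A.ambient
      rw [← hB]
      exact inf_le_left
    rw [← Finset.sum_Ico_add_eq_sum_Icc hle] at h1 h2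
    rw [Finset.sum_congr rfl fun K hK => ih K (Finset.mem_Ico.1 hK).2] at h1
    have h3 := h1.trans ((if_congr Iff.rfl rfl rfl).trans h2.symm)
    exact add_left_cancel h3

/-- By `mob_sign` all flats of dimension i have Möbius values of one sign, so the absolute values
become a global sign and the sum becomes linear in `altSum`. -/
theorem whitney_eq (A : Arrangement d) (i : ℕ) :
    (A.whitney i : ℤ) = (-1) ^ (finrank ℝ A.ambient + i) *
      altSum A.ambient A.hyps fun K => if finrank ℝ K = i then 1 else 0 := by
  have h1 : (A.whitney i : ℤ) = ∑ F : A.FlatLattice,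
      if finrank ℝ (OrderDual.ofDual F).1 = i
        then (-1) ^ (finrank ℝ A.ambient + i) * A.mob (OrderDual.ofDual F).1 else 0 := by
    rw [whitney, Nat.cast_sum]
    refine Finset.sum_congr rfl fun F _ => ?_
    split_ifs with h
    · rw [mu_eq_mob, Int.natCast_natAbs, ← h, ← abs_of_nonneg (A.mob_sign _), abs_mul, abs_pow,
        abs_neg, abs_one, one_pow, one_mul]
    · rfl
  rw [h1]
  simp only [mob, altSum, Finset.mul_sum]
  rw [← Finset.sum_filter, Finset.sum_comm]
  refine Finset.sum_congr rfl fun B hB => ?_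
  rw [Finset.sum_filter, Finset.sum_eq_single (OrderDual.toDual ⟨A.ambient ⊓ B.inf id,
      Finset.mem_image.2 ⟨B, hB, rfl⟩⟩ : A.FlatLattice)]
  · simp only [OrderDual.ofDual_toDual, if_true, mul_one, mul_ite, mul_zero]
    exact if_congr Iff.rfl rfl rfl
  · intro K _ hK
    have : A.ambient ⊓ B.inf id ≠ (OrderDual.ofDual K).1 := fun h => hK (Subtype.ext h.symm)
    rw [if_neg this, mul_zero, mul_zero, ite_self]
  · simp

theorem whitney_recurrence (A : Arrangement d) {H : Submodule ℝ (E d)} (hH : H ∈ A.hyps)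
    (i : ℕ) : A.whitney i = (A.delete H).whitney i + (A.restrict H hH).whitney i := by
  zify
  rw [whitney_eq, whitney_eq, whitney_eq, A.altSum_eq hH]
  have h3 : (-1 : ℤ) ^ (finrank ℝ A.ambient + i) =
      -(-1) ^ (finrank ℝ (A.restrict H hH).ambient + i) := by
    change _ = -(-1) ^ (finrank ℝ H + _)
    rw [← A.codim_one H hH, add_right_comm, pow_succ]; ring
  change _ = (-1) ^ (finrank ℝ A.ambient + i) * _ + _
  rw [mul_sub, h3]
  ring

theorem whitney_of_hyps_eq_empty {A : Arrangement d} (h : A.hyps = ∅) (i : ℕ) :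
    A.whitney i = if finrank ℝ A.ambient = i then 1 else 0 := by
  rw [← Int.natCast_inj, whitney_eq, h]
  have h1 : altSum A.ambient ∅ (fun K => if finrank ℝ K = i then 1 else 0) =
      if finrank ℝ A.ambient = i then 1 else 0 := by
    simp only [altSum, Finset.powerset_empty, Finset.sum_singleton, Finset.card_empty, pow_zero,
      one_mul]
    rw [show A.ambient ⊓ (∅ : Finset (Submodule ℝ (E d))).inf id = A.ambient from inf_top_eq _]
  rw [h1]
  by_cases hi : finrank ℝ A.ambient = i
  · rw [if_pos hi, if_pos hi, hi, Even.neg_one_pow ⟨_, rfl⟩, mul_one, Nat.cast_one]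
  · rw [if_neg hi, if_neg hi, mul_zero, Nat.cast_zero]

theorem finrank_ambient_lt (A : Arrangement d) : finrank ℝ A.ambient < d + 1 := by
  have := finrank_le A.ambient
  rw [finrank_euclideanSpace_fin] at this
  omega

variable {G : Type*} [AddCommGroup G]

/-- The combination of the Whitney numbers with coefficients `g`. -/
noncomputable def whitneySum (g : Fin (d + 1) → G) (A : Arrangement d) : G :=
  ∑ k : Fin (d + 1), A.whitney k • g k

theorem whitneySum_recurrence (g : Fin (d + 1) → G) (A : Arrangement d)
    {H : Submodule ℝ (E d)} (hH : H ∈ A.hyps) :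
    whitneySum g A = whitneySum g (A.delete H) + whitneySum g (A.restrict H hH) := by
  simp only [whitneySum, A.whitney_recurrence hH, add_smul, Finset.sum_add_distrib]

theorem whitneySum_of_hyps_eq_empty (g : Fin (d + 1) → G) {A : Arrangement d}
    (h : A.hyps = ∅) : whitneySum g A = g ⟨finrank ℝ A.ambient, A.finrank_ambient_lt⟩ := by
  rw [whitneySum, Finset.sum_eq_single ⟨finrank ℝ A.ambient, A.finrank_ambient_lt⟩]
  · simp [whitney_of_hyps_eq_empty h]
  · intro k _ hk
    rw [whitney_of_hyps_eq_empty h, if_neg fun h' => hk (Fin.ext h'.symm), zero_smul]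
  · simp

theorem eq_whitneySum {ψ : Arrangement d → G}
    (hrec : ∀ (A : Arrangement d) (H : Submodule ℝ (E d)) (hH : H ∈ A.hyps),
      ψ A = ψ (A.delete H) + ψ (A.restrict H hH)) (g : Fin (d + 1) → G)
    (hbase : ∀ A : Arrangement d, A.hyps = ∅ →
      ψ A = g ⟨finrank ℝ A.ambient, A.finrank_ambient_lt⟩) (A : Arrangement d) :
    ψ A = whitneySum g A := by
  induction A using delRestInduction with
  | empty A h => rw [hbase A h, whitneySum_of_hyps_eq_empty g h]
  | step A H hH h1 h2 => rw [hrec A H hH, h1, h2, ← whitneySum_recurrence g A hH]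

/-- The version of `eq_whitneySum` for nonempty arrangements. -/
theorem eq_whitneySum_of_nonempty {ψ : Arrangement d → G}
    (hrec : ∀ (A : Arrangement d) (H : Submodule ℝ (E d)) (hH : H ∈ A.hyps),
      (A.delete H).hyps.Nonempty → (A.restrict H hH).hyps.Nonempty →
        ψ A = ψ (A.delete H) + ψ (A.restrict H hH)) (g : Fin (d + 1) → G)
    (hbase : ∀ (A : Arrangement d) (H : Submodule ℝ (E d)), A.hyps = {H} →
      ψ A = whitneySum g A) (A : Arrangement d) (hA : A.hyps.Nonempty) :
    ψ A = whitneySum g A := by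
  induction A using delRestInduction with
  | empty A h => simp [h] at hA
  | step A H hH h1 h2 =>
    rcases (A.hyps.erase H).eq_empty_or_nonempty with h | h
    · exact hbase A H (by rw [← Finset.insert_erase hH, h]; rfl)
    · have h' : (A.restrict H hH).hyps.Nonempty := h.image _
      rw [hrec A H hH h h', h1 h, h2 h', ← whitneySum_recurrence g A hH]

end Arrangement

theorem fanVol_fan (k : ℕ) (A : Arrangement d) : fanVol k A.fan = A.whitney k := by
  induction A using Arrangement.delRestInduction with
  | empty A h =>
    rw [Arrangement.fan_of_hyps_eq_empty h, Arrangement.whitney_of_hyps_eq_empty h, fanVol,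
      finsum_mem_singleton, coneVol_submodule]
    split_ifs <;> simp
  | step A H hH h1 h2 =>
    rw [(isFanValuation_fanVol k).map_fan A hH, h1, h2, A.whitney_recurrence hH, Nat.cast_add]

theorem finsum_genericVal_fan {G : Type*} [AddCommGroup G] (g : Fin (d + 1) → G)
    (A : Arrangement d) : ∑ᶠ C ∈ A.fan, genericVal g C = A.whitneySum g :=
  Arrangement.eq_whitneySum (ψ := fun A => ∑ᶠ C ∈ A.fan, genericVal g C)
    (fun A _ hH => (isConeValuation_genericVal g).isFanValuation.map_fan A hH) g
    (fun A h => by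
      rw [Arrangement.fan_of_hyps_eq_empty h, finsum_mem_singleton]
      exact genericVal_submodule g _ _ rfl) A

/-! ### Transitivity of rotations -/

/-- The action of a linear isometry on subspaces. -/
noncomputable abbrev mapSub (r : E d ≃ₗᵢ[ℝ] E d) (L : Submodule ℝ (E d)) : Submodule ℝ (E d) :=
  L.map (r.toLinearEquiv : E d →ₗ[ℝ] E d)

theorem mapSub_trans (r r' : E d ≃ₗᵢ[ℝ] E d) (L : Submodule ℝ (E d)) :
    mapSub (r.trans r') L = mapSub r' (mapSub r L) := by
  ext x
  simp only [mapSub, Submodule.mem_map, exists_exists_and_eq_and]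
  rfl

theorem finrank_mapSub (r : E d ≃ₗᵢ[ℝ] E d) (L : Submodule ℝ (E d)) :
    finrank ℝ (mapSub r L) = finrank ℝ L := LinearEquiv.finrank_map_eq _ _

theorem det_trans (r r' : E d ≃ₗᵢ[ℝ] E d) :
    LinearMap.det ((r.trans r').toLinearEquiv : E d →ₗ[ℝ] E d) =
      LinearMap.det (r'.toLinearEquiv : E d →ₗ[ℝ] E d) *
        LinearMap.det (r.toLinearEquiv : E d →ₗ[ℝ] E d) := by
  rw [← LinearMap.det_comp]
  rfl

theorem det_reflection_singleton {v : E d} (hv : v ≠ 0) :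
    LinearMap.det ((reflection (ℝ ∙ v)ᗮ).toLinearEquiv : E d →ₗ[ℝ] E d) = -1 := by
  have := det_reflection (ℝ ∙ v)ᗮ
  rw [orthogonal_orthogonal, finrank_span_singleton hv, pow_one] at this
  exact this

/-- Every isometry is a product of reflections. -/
theorem det_eq_one_or_neg_one (r : E d ≃ₗᵢ[ℝ] E d) :
    LinearMap.det (r.toLinearEquiv : E d →ₗ[ℝ] E d) = 1 ∨
      LinearMap.det (r.toLinearEquiv : E d →ₗ[ℝ] E d) = -1 := by
  obtain ⟨l, -, rfl⟩ := r.reflections_generate_dim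
  induction l with
  | nil =>
    left
    change LinearMap.det (LinearMap.id : E d →ₗ[ℝ] E d) = 1
    exact LinearMap.det_id
  | cons v l ih =>
    have h : LinearMap.det ((reflection (ℝ ∙ v)ᗮ).toLinearEquiv : E d →ₗ[ℝ] E d) = 1 ∨
        LinearMap.det ((reflection (ℝ ∙ v)ᗮ).toLinearEquiv : E d →ₗ[ℝ] E d) = -1 := by
      have := det_reflection (ℝ ∙ v)ᗮ
      rcases neg_one_pow_eq_or ℝ (finrank ℝ ((ℝ ∙ v)ᗮᗮ : Submodule ℝ (E d))) with h | h <;>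
        rw [h] at this
      · exact Or.inl this
      · exact Or.inr this
    rw [List.map_cons, List.prod_cons]
    have e := det_trans (List.map (fun v => reflection (ℝ ∙ v)ᗮ) l).prod (reflection (ℝ ∙ v)ᗮ)
    change LinearMap.det ((((List.map (fun v => reflection (ℝ ∙ v)ᗮ) l).prod).trans
      (reflection (ℝ ∙ v)ᗮ)).toLinearEquiv : E d →ₗ[ℝ] E d) = 1 ∨ LinearMap.det
      ((((List.map (fun v => reflection (ℝ ∙ v)ᗮ) l).prod).trans
      (reflection (ℝ ∙ v)ᗮ)).toLinearEquiv : E d →ₗ[ℝ] E d) = -1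
    rw [e]
    rcases h with h | h <;> rcases ih with h' | h' <;> rw [h, h'] <;> norm_num

theorem mapSub_eq_self_of_fixed {r : E d ≃ₗᵢ[ℝ] E d} {L : Submodule ℝ (E d)}
    (h : ∀ x ∈ L, r x = x) : mapSub r L = L := by
  ext x
  constructor
  · rintro ⟨y, hy, rfl⟩
    change r y ∈ L
    rwa [h y hy]
  · exact fun hx => ⟨x, hx, h x hx⟩

theorem exists_isometry_mapSub_eq {H H' : Submodule ℝ (E d)} (h : finrank ℝ H = finrank ℝ H') :
    ∃ r : E d ≃ₗᵢ[ℝ] E d, mapSub r H = H' := by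
  let e : H ≃ₗᵢ[ℝ] H' := (stdOrthonormalBasis ℝ H).equiv (stdOrthonormalBasis ℝ H') (finCongr h)
  let r : E d ≃ₗᵢ[ℝ] E d :=
    (H'.subtypeₗᵢ.comp e.toLinearIsometry).extend.toLinearIsometryEquiv rfl
  have hr : ∀ x : H, r x = e x := fun x => LinearIsometry.extend_apply _ x
  refine ⟨r, eq_of_le_of_finrank_eq ?_ (by rw [finrank_mapSub, h])⟩
  rintro _ ⟨x, hx, rfl⟩
  change r x ∈ H'
  rw [hr ⟨x, hx⟩]
  exact (e ⟨x, hx⟩).2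

theorem exists_unit_normal {H L : Submodule ℝ (E d)} (hHL : H ≤ L)
    (h : finrank ℝ H + 1 = finrank ℝ L) :
    ∃ w : E d, ‖w‖ = 1 ∧ (∀ x ∈ H, ⟪w, x⟫_ℝ = 0) ∧ L = H ⊔ (ℝ ∙ w) := by
  have hne : Hᗮ ⊓ L ≠ ⊥ := fun hbot => by
    have h2 := sup_orthogonal_inf_of_hasOrthogonalProjection hHL
    rw [hbot, sup_bot_eq] at h2
    rw [h2] at h
    omega
  obtain ⟨u, hu, hu0⟩ := exists_mem_ne_zero_of_ne_bot hne
  have hw : ‖(‖u‖⁻¹ : ℝ) • u‖ = 1 := norm_smul_inv_norm hu0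
  have hwm := smul_mem _ (‖u‖⁻¹ : ℝ) hu
  refine ⟨_, hw, fun x hx => (mem_orthogonal' _ _).1 hwm.1 x hx, ?_⟩
  set w := (‖u‖⁻¹ : ℝ) • u
  have hle : H ⊔ (ℝ ∙ w) ≤ L := sup_le hHL ((span_singleton_le_iff_mem _ _).2 hwm.2)
  refine (eq_of_le_of_finrank_le hle ?_).symm
  rw [← h]
  refine finrank_lt_finrank_of_lt (lt_of_le_of_ne le_sup_left fun he => ?_)
  have hwH : w ∈ H := he ▸ mem_sup_right (mem_span_singleton_self w)
  have := inner_self_eq_zero.1 ((mem_orthogonal' _ _).1 hwm.1 w hwH)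
  rw [this, norm_zero] at hw
  exact zero_ne_one hw

theorem mapSub_sup_singleton (r : E d ≃ₗᵢ[ℝ] E d) (H : Submodule ℝ (E d)) (w : E d) :
    mapSub r (H ⊔ (ℝ ∙ w)) = mapSub r H ⊔ (ℝ ∙ r w) := by
  rw [mapSub, Submodule.map_sup, map_span, Set.image_singleton]
  rfl

theorem reflection_fixes {H : Submodule ℝ (E d)} {v : E d} (hv : ∀ x ∈ H, ⟪v, x⟫_ℝ = 0) :
    mapSub (reflection (ℝ ∙ v)ᗮ) H = H :=
  mapSub_eq_self_of_fixed fun x hx =>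
    reflection_mem_subspace_eq_self (mem_orthogonal_singleton_iff_inner_right.2 (hv x hx))

/-- After H is carried to H', reflecting along w - w' matches the unit normals w and w' while fixing
H'. If the determinant is -1, the reflection along w' corrects it, since it preserves both H' and
L'. -/
theorem exists_rotation_flag {H L H' L' : Submodule ℝ (E d)} (hHL : H ≤ L) (hHL' : H' ≤ L')
    (h : finrank ℝ H + 1 = finrank ℝ L) (h' : finrank ℝ H' + 1 = finrank ℝ L')
    (hLL : finrank ℝ L = finrank ℝ L') :
    ∃ r : E d ≃ₗᵢ[ℝ] E d, IsRotation r ∧ mapSub r H = H' ∧ mapSub r L = L' := by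
  obtain ⟨r₁, hr₁⟩ := exists_isometry_mapSub_eq (H := H) (H' := H') (by omega)
  obtain ⟨w, hw, hwH, hwL⟩ := exists_unit_normal (H := H') (L := mapSub r₁ L)
    (hr₁ ▸ Submodule.map_mono hHL) (by rw [finrank_mapSub]; omega)
  obtain ⟨w', hw', hwH', hwL'⟩ := exists_unit_normal hHL' h'
  set ρ := reflection (ℝ ∙ (w - w'))ᗮ with hρ
  have hρH : mapSub ρ H' = H' := reflection_fixes fun x hx => by
    rw [inner_sub_left, hwH x hx, hwH' x hx, sub_zero]
  have hρL : mapSub ρ (mapSub r₁ L) = L' := by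
    rw [hwL, mapSub_sup_singleton, hρH, hρ, reflection_sub (hw.trans hw'.symm), ← hwL']
  set σ := reflection (ℝ ∙ w')ᗮ with hσ
  have hσH : mapSub σ H' = H' := reflection_fixes hwH'
  have hσL : mapSub σ L' = L' := by
    conv_lhs => rw [hwL', mapSub_sup_singleton, hσH, hσ,
      reflection_orthogonalComplement_singleton_eq_neg, ← Set.neg_singleton, Submodule.span_neg]
    exact hwL'.symm
  rcases det_eq_one_or_neg_one (r₁.trans ρ) with hdet | hdet
  · exact ⟨_, hdet, by rw [mapSub_trans, hr₁, hρH], by rw [mapSub_trans, hρL]⟩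
  · refine ⟨(r₁.trans ρ).trans σ, ?_, by rw [mapSub_trans, mapSub_trans, hr₁, hρH, hσH],
      by rw [mapSub_trans, mapSub_trans, hρL, hσL]⟩
    have hw0 : w' ≠ 0 := fun h0 => by rw [h0, norm_zero] at hw'; exact zero_ne_one hw'
    rw [IsRotation, det_trans, hdet, det_reflection_singleton hw0]
    norm_num

theorem exists_finrank_add_one {L : Submodule ℝ (E d)} (h : finrank ℝ L ≠ 0) :
    ∃ H ≤ L, finrank ℝ H + 1 = finrank ℝ L := by
  obtain ⟨u, hu, hu0⟩ := exists_mem_ne_zero_of_ne_bot fun hbot => h (finrank_eq_zero.2 hbot)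
  have h1 := finrank_add_inf_finrank_orthogonal ((span_singleton_le_iff_mem u L).2 hu)
  rw [finrank_span_singleton hu0] at h1
  exact ⟨_, inf_le_right, by rw [← h1, add_comm]⟩

theorem exists_rotation_mapSub_eq {L L' : Submodule ℝ (E d)} (h : finrank ℝ L = finrank ℝ L') :
    ∃ r : E d ≃ₗᵢ[ℝ] E d, IsRotation r ∧ mapSub r L = L' := by
  -- The zero subspace contains no hyperplane to complete to a flag.
  by_cases h0 : finrank ℝ L = 0
  · refine ⟨LinearIsometryEquiv.refl ℝ _, ?_, ?_⟩
    · exact LinearMap.det_id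
    · rw [finrank_eq_zero.1 h0, finrank_eq_zero.1 (h.symm.trans h0), mapSub, Submodule.map_bot]
  · obtain ⟨H, hHL, hH⟩ := exists_finrank_add_one h0
    obtain ⟨H', hHL', hH'⟩ := exists_finrank_add_one (h ▸ h0)
    obtain ⟨r, hr, -, hL⟩ := exists_rotation_flag hHL hHL' hH hH' h
    exact ⟨r, hr, hL⟩

/-! ### Deletion-restriction invariants -/

namespace Arrangement

theorem map_eq_of_hyps_eq_empty {A B : Arrangement d} {r : E d ≃ₗᵢ[ℝ] E d} (hA : A.hyps = ∅)
    (hB : B.hyps = ∅) (h : mapSub r A.ambient = B.ambient) : A.map r = B :=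
  Arrangement.ext h (by
    change A.hyps.image _ = B.hyps
    rw [hA, hB, Finset.image_empty])

theorem map_eq_of_hyps_eq_singleton {A B : Arrangement d} {H K : Submodule ℝ (E d)}
    {r : E d ≃ₗᵢ[ℝ] E d} (hA : A.hyps = {H}) (hB : B.hyps = {K})
    (h : mapSub r A.ambient = B.ambient) (hHK : mapSub r H = K) : A.map r = B :=
  Arrangement.ext h (by
    change A.hyps.image _ = B.hyps
    rw [hA, hB, Finset.image_singleton, ← hHK])

theorem exists_eq_comp_finrank {G : Type*} [AddCommGroup G] (P : Set (Arrangement d))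
    (ψ : Arrangement d → G)
    (h : ∀ A ∈ P, ∀ B ∈ P, finrank ℝ A.ambient = finrank ℝ B.ambient → ψ A = ψ B) :
    ∃ c : ℕ → G, ∀ A ∈ P, ψ A = c (finrank ℝ A.ambient) := by
  refine ⟨fun n => if hn : ∃ A ∈ P, finrank ℝ A.ambient = n then ψ hn.choose else 0,
    fun A hA => ?_⟩
  have hn : ∃ B ∈ P, finrank ℝ B.ambient = finrank ℝ A.ambient := ⟨A, hA, rfl⟩
  simp only [dif_pos hn]
  exact h A hA _ hn.choose_spec.1 hn.choose_spec.2.symm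

theorem exists_whitneySum_eq {G : Type*} [AddCommGroup G] {ψ : Arrangement d → G}
    (hrec : ∀ (A : Arrangement d) (H : Submodule ℝ (E d)) (hH : H ∈ A.hyps),
      ψ A = ψ (A.delete H) + ψ (A.restrict H hH))
    (hrot : ∀ r : E d ≃ₗᵢ[ℝ] E d, IsRotation r → ∀ A : Arrangement d, A.hyps = ∅ →
      ψ (A.map r) = ψ A) :
    ∃ g : Fin (d + 1) → G, ∀ A, ψ A = whitneySum g A := by
  obtain ⟨c, hc⟩ := exists_eq_comp_finrank {A : Arrangement d | A.hyps = ∅} ψ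
    fun A (hA : _ = _) B (hB : _ = _) h => by
      obtain ⟨r, hr, hAB⟩ := exists_rotation_mapSub_eq h
      rw [← hrot r hr A hA, map_eq_of_hyps_eq_empty hA hB hAB]
  exact ⟨fun k => c k, eq_whitneySum hrec _ fun A hA => hc A hA⟩

theorem exists_whitneySum_eq_of_nonempty {G : Type*} [AddCommGroup G] {ψ : Arrangement d → G}
    (hψ : IsDelRestInvariant {A : Arrangement d | A.hyps.Nonempty} ψ) :
    ∃ g : Fin (d + 1) → G, ∀ A : Arrangement d, A.hyps.Nonempty → ψ A = whitneySum g A := by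
  obtain ⟨c, hc⟩ := exists_eq_comp_finrank {A : Arrangement d | ∃ H, A.hyps = {H}} ψ (by
    rintro A ⟨H, hA⟩ B ⟨K, hB⟩ h
    have hH : H ∈ A.hyps := hA ▸ Finset.mem_singleton_self H
    have hK : K ∈ B.hyps := hB ▸ Finset.mem_singleton_self K
    obtain ⟨r, hr, hHK, hAB⟩ := exists_rotation_flag (A.le_ambient H hH) (B.le_ambient K hK)
      (A.codim_one H hH) (B.codim_one K hK) h
    rw [← hψ.rotation r hr A ⟨H, hH⟩, map_eq_of_hyps_eq_singleton hA hB hAB hHK])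
  -- On a single hyperplane in dimension k + 1 the Whitney sum is g (k+1) + g k. The start g 0 = 0
  -- is an arbitrary choice.
  let g : ℕ → G := fun n => Nat.rec 0 (fun k x => c (k + 1) - x) n
  have hg : ∀ k, g (k + 1) + g k = c (k + 1) := fun k => sub_add_cancel _ _
  refine ⟨fun k => g k, eq_whitneySum_of_nonempty
    (fun A H hH h1 h2 => hψ.recurrence A ⟨H, hH⟩ H hH h1 h2) _ fun A H hA => ?_⟩
  have hH : H ∈ A.hyps := hA ▸ Finset.mem_singleton_self H
  have h1 : (A.delete H).hyps = ∅ := by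
    change A.hyps.erase H = ∅
    rw [hA, Finset.erase_singleton]
  have h2 : (A.restrict H hH).hyps = ∅ := by
    change (A.hyps.erase H).image _ = ∅
    rw [hA, Finset.erase_singleton, Finset.image_empty]
  rw [whitneySum_recurrence _ A hH, whitneySum_of_hyps_eq_empty _ h1,
    whitneySum_of_hyps_eq_empty _ h2, hc A ⟨H, hA⟩]
  change c (finrank ℝ A.ambient) = g (finrank ℝ A.ambient) + g (finrank ℝ H)
  rw [← A.codim_one H hH, hg]

theorem fan_map_of_hyps_eq_empty {A : Arrangement d} (h : A.hyps = ∅) (r : E d ≃ₗᵢ[ℝ] E d) :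
    (A.map r).fan = (fun C => r '' C) '' A.fan := by
  have h' : (A.map r).hyps = ∅ := by
    change A.hyps.image _ = ∅
    rw [h, Finset.image_empty]
  rw [fan_of_hyps_eq_empty h, fan_of_hyps_eq_empty h', Set.image_singleton]
  rfl

theorem isFan_fan_of_hyps_eq_empty {A : Arrangement d} (h : A.hyps = ∅) : IsFan A.fan := by
  have hc : A.complement = offHyps A.ambient ∅ := by simp [complement, h, offHyps]
  rw [fan_eq_chambers hc]
  exact isFan_chambers _ _

end Arrangement

theorem exists_whitneySum_eq_of_isFanValuation {G : Type*} [AddCommGroup G]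
    {φ : Set (Set (E d)) → G} (hφ : IsFanValuation φ) (hrot : IsRotationInvariant φ) :
    ∃ g : Fin (d + 1) → G, ∀ A : Arrangement d, φ A.fan = A.whitneySum g :=
  Arrangement.exists_whitneySum_eq (ψ := fun A => φ A.fan) (fun A _ hH => hφ.map_fan A hH)
    fun r hr A hA => by
      rw [Arrangement.fan_map_of_hyps_eq_empty hA r]
      exact hrot r hr _ (Arrangement.isFan_fan_of_hyps_eq_empty hA)

theorem IsDelRestInvariant.exists_whitneySum_eq {G : Type*} [AddCommGroup G]
    {𝒞 : Set (Arrangement d)}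
    (h𝒞 : 𝒞 = Set.univ ∨ 𝒞 = {A : Arrangement d | A.hyps.Nonempty}) {ψ : Arrangement d → G}
    (hψ : IsDelRestInvariant 𝒞 ψ) :
    ∃ g : Fin (d + 1) → G, ∀ A ∈ 𝒞, ψ A = A.whitneySum g := by
  rcases h𝒞 with rfl | rfl
  · obtain ⟨g, hg⟩ := Arrangement.exists_whitneySum_eq
      (fun A H hH => hψ.recurrence A trivial H hH trivial trivial)
      fun r hr A _ => hψ.rotation r hr A trivial
    exact ⟨g, fun A _ => hg A⟩
  · exact Arrangement.exists_whitneySum_eq_of_nonempty hψ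

theorem isFanValuation_sum_fanVol_smul {G : Type*} [AddCommGroup G] [Module ℝ G]
    (g : Fin (d + 1) → G) :
    IsFanValuation (fun N : Set (Set (E d)) => ∑ k : Fin (d + 1), fanVol k N • g k) where
  map_empty := Finset.sum_eq_zero fun k _ => by
    rw [(isFanValuation_fanVol k).map_empty, zero_smul]
  map_cut N hN u hu hu0 := by
    rw [← Finset.sum_add_distrib, ← Finset.sum_sub_distrib]
    refine Finset.sum_congr rfl fun k _ => ?_
    rw [← add_smul, ← sub_smul, ← (isFanValuation_fanVol k).map_cut N hN u hu hu0]

end FanArr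

theorem theorem1p1 (d : ℕ) (G : Type*) [AddCommGroup G] :
    -- rotation-invariant fan valuations on arrangements are combinations of Whitney numbers
    (∀ φ : Set (Set (FanArr.E d)) → G,
      FanArr.IsFanValuation φ → FanArr.IsRotationInvariant φ →
        ∃ g : Fin (d + 1) → G, ∀ A : FanArr.Arrangement d,
          φ A.fan = ∑ k : Fin (d + 1), A.whitney k • g k) ∧
    -- the converse, both for all arrangements and for nonempty arrangements only
    (∀ 𝒞 : Set (FanArr.Arrangement d),
      𝒞 = Set.univ ∨ 𝒞 = {A : FanArr.Arrangement d | A.hyps.Nonempty} →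
      ∀ ψ : FanArr.Arrangement d → G, FanArr.IsDelRestInvariant 𝒞 ψ →
        (∃ φ : Set (Set (FanArr.E d)) → G, FanArr.IsFanValuation φ ∧
          ∀ A ∈ 𝒞, ψ A = φ A.fan) ∧
        ∃ g : Fin (d + 1) → G,
          -- on fans of arrangements the spherical intrinsic volumes are natural numbers,
          -- and `ψ` is their combination with coefficients `g`
          (∀ A ∈ 𝒞, (∀ k : ℕ, FanArr.fanVol k A.fan = A.whitney k) ∧
            ψ A = ∑ k : Fin (d + 1), A.whitney k • g k) ∧
          -- if `G` is a real vector space, this combination is defined on all fans and is a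
          -- rotation-invariant fan valuation
          (∀ _ : Module ℝ G,
            FanArr.IsFanValuation
              (fun N : Set (Set (FanArr.E d)) => ∑ k : Fin (d + 1), FanArr.fanVol k N • g k) ∧
            FanArr.IsRotationInvariant
              (fun N : Set (Set (FanArr.E d)) => ∑ k : Fin (d + 1), FanArr.fanVol k N • g k) ∧
            ∀ A ∈ 𝒞, ψ A = ∑ k : Fin (d + 1), FanArr.fanVol k A.fan • g k)) := by
  refine ⟨fun φ hφ hrot => FanArr.exists_whitneySum_eq_of_isFanValuation hφ hrot,
    fun 𝒞 h𝒞 ψ hψ => ?_⟩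
  obtain ⟨g, hg⟩ := hψ.exists_whitneySum_eq h𝒞
  -- Over an arbitrary group only some fan valuation is needed, so the choice of ultrafilter need
  -- not respect rotations.
  refine ⟨⟨fun N => ∑ᶠ C ∈ N, FanArr.genericVal g C,
    (FanArr.isConeValuation_genericVal g).isFanValuation, fun A hA => ?_⟩, g,
    fun A hA => ⟨fun k => FanArr.fanVol_fan k A, hg A hA⟩,
    fun _ => ⟨FanArr.isFanValuation_sum_fanVol_smul g, fun r hr N hN => ?_, fun A hA => ?_⟩⟩
  · rw [hg A hA]
    exact (FanArr.finsum_genericVal_fan g A).symm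
  · refine Finset.sum_congr rfl fun k _ => ?_
    rw [FanArr.isRotationInvariant_fanVol k r hr N hN]
  · rw [hg A hA]
    refine Finset.sum_congr rfl fun k _ => ?_
    rw [FanArr.fanVol_fan, Nat.cast_smul_eq_nsmul]
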